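/- **Theorem 1 (Mixed policy gradient estimator).** *Setting.* Let $\mathcal S\subseteq\mathbb R^{d}$, let $\mathcal X$ be a finite set and $\mathcal B^x\subseteq\mathbb R^p$ for $x\in\mathcal X$. Let $\xi_0,\xi_1,\dots$ be i.i.d. random variables in a measurable space $\Xi$, let $f(s,(x,b),\xi)\in\mathcal S$ and $c(s,(x,b),\xi)\in\mathbb R$ be measurable transition and cost functions ($s\in\mathcal S$, $x\in\mathcal X$, $b\in\mathcal B^x$, $\xi\in\Xi$), and let $\gamma\in(0,1)$. For $\theta=(\phi,\kappa)\in\mathbb R^m\times\mathbb R^n$, let $\pi^{\mathcal X}_\phi(\cdot\mid s)$ be a probability distribution on $\mathcal X$ and $b_\kappa(s,x)\in\mathcal B^x$, both measurable in $s$. Fix $s_0\in\mathcal S$. For fixed sequences $x_{0:\infty}$ and $\xi_{0:\infty}$ put $s_0(\kappa)=s_0$, $b_t(\kappa)=b_\kappa(s_t(\kappa),x_t)$, $s_{t+1}(\kappa)=f(s_t(\kappa),(x_t,b_t(\kappa)),\xi_t)$ and $c_t(\kappa)=c(s_t(\kappa),(x_t,b_t(\kappa)),\xi_t)$. Let $\mathbb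 E_\theta$ be the expectation under the law of $(x_{0:\infty},\xi_{0:\infty})$ for which, given $x_{0:t-1}$ and $\xi_{0:t-1}$, the action $x_t$ has law $\pi^{\mathcal X}_\phi(\cdot\mid s_t(\kappa))$ and $\xi_t$ is independent of $x_t$ and has the noise law. Let $J(\phi,\kappa)=\mathbb E_\theta\big[\sum_{t\ge0}\gamma^t c_t(\kappa)\big]$, and let $Q_{\pi_\theta}(s,a)$ be the expected discounted cost when action $a=(x,b)$ is taken in state $s$ and the policy $\pi_\theta=(\pi^{\mathcal X}_\phi,b_\kappa)$ is followed afterwards. Write $a_t=(x_t,b_t(\kappa))$. *Assumptions.* 1. For all $x,\xi$, the maps $(s,b)\mapsto f(s,(x,b),\xi)$ and $(s,b)\mapsto c(s,(x,b),\xi)$ are continuous and a.e. differentiable on $\mathcal S\times\mathcal B^x$. 2. For all $\phi,x$, the map $s\mapsto\pi^{\mathcal X}_\phi(x\mid s)$ is continuous and a.e. differentiable on $\mathcal S$. 3. For all $s\in\mathcal S$ and $x$, the map $\kappa\mapsto b_\kappa(s,x)$ is continuous and a.e. differentiable. 4. For each $(\phi,\kappa)$: (a) for almost every scenario $\xi_{0:\infty}$,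 the gradients $\nabla_\phi\log\pi^{\mathcal X}_\phi(x_t\mid s_t(\kappa))$, $\nabla_\kappa\log\pi^{\mathcal X}_\phi(x_t\mid s_t(\kappa))$ and $\nabla_\kappa c_t(\kappa)$ exist for all $t$ and all $x_{0:\infty}$; (b) they are uniformly bounded near $(\phi,\kappa)$ in the following sense: there are balls $U\ni\phi$ and $V\ni\kappa$ around these points and a constant $L$ such that for almost every scenario and all $t$, $x_{0:\infty}$, one has $\pi^{\mathcal X}_{\phi'}(x_t\mid s_t(\kappa'))>0$ for $(\phi',\kappa')\in U\times V$, and the following are $L$-Lipschitz: $\phi'\mapsto\log\pi^{\mathcal X}_{\phi'}(x_t\mid s_t(\kappa'))$ on $U$ for each $\kappa'\in V$, $\kappa'\mapsto\log\pi^{\mathcal X}_{\phi'}(x_t\mid s_t(\kappa'))$ on $V$ for each $\phi'\in U$, and $\kappa'\mapsto c_t(\kappa')$ on $V$. 5. The cost $c$ is bounded. *Conclusion.* For every $(\phi,\kappa)$, the objective $J$ is differentiable in $\phi$ and in $\kappa$ at $(\phi,\kappa)$, with $$\nabla_\phi J(\phi,\kappa)=\mathbb E_\theta\Big[\sum_{t\ge0}\gamma^t\,\nabla_\phi\log\pi^{\mathcal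 X}_\phi(x_t\mid s_t(\kappa))\,Q_{\pi_\theta}(s_t(\kappa),a_t)\Big],$$ $$\nabla_\kappa J(\phi,\kappa)=\underbrace{\mathbb E_\theta\Big[\sum_{t\ge0}\gamma^t\,\nabla_\kappa c_t(\kappa)\Big]}_{\text{pathwise term}}+\underbrace{\mathbb E_\theta\Big[\sum_{t\ge0}\gamma^t\,\nabla_\kappa\log\pi^{\mathcal X}_\phi(x_t\mid s_t(\kappa))\,Q_{\pi_\theta}(s_t(\kappa),a_t)\Big]}_{\text{cross term}}.$$ All four series (including the one defining $J$) converge absolutely almost surely and have integrable sums. Moreover, if the existence of gradients in 4(a) holds at $(\phi,\kappa)$ jointly in both parameters (for almost every scenario, $(\phi',\kappa')\mapsto\log\pi^{\mathcal X}_{\phi'}(x_t\mid s_t(\kappa'))$ is differentiable at $(\phi,\kappa)$ for all $t$, $x_{0:\infty}$), then $J$ is (Fréchet) differentiable at $(\phi,\kappa)$ as a function of $\theta=(\phi,\kappa)$. -/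

import Mathlib

open MeasureTheory ProbabilityTheory
open scoped Gradient

noncomputable section

/-- A discounted, infinite-horizon hybrid MDP in disturbance form. States form a subset of `ℝ^d`;
an action is a pair `(x, b)` with `x` in the finite set `X` and `b` in the feasible set
`feasible x ⊆ ℝ^p`. The exogenous noise `ξ_t` is i.i.d. with law `noise` on `Ξ`.
The maps are written as total functions on the ambient Euclidean spaces; only their values at
states and feasible actions ever matter. -/
structure HybridMDP (X Ξ : Type*) [Fintype X] [MeasurableSpace X] [DiscreteMeasurableSpace X]
    [MeasurableSpace Ξ] (d p : ℕ) where
  /-- The state space `S ⊆ ℝ^d`. -/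
  states : Set (EuclideanSpace ℝ (Fin d))
  /-- The feasible continuous actions `B^x ⊆ ℝ^p`. -/
  feasible : X → Set (EuclideanSpace ℝ (Fin p))
  /-- The transition map `f(s, (x, b), ξ)`. -/
  f : EuclideanSpace ℝ (Fin d) → X → EuclideanSpace ℝ (Fin p) → Ξ → EuclideanSpace ℝ (Fin d)
  /-- The cost `c(s, (x, b), ξ)`. -/
  c : EuclideanSpace ℝ (Fin d) → X → EuclideanSpace ℝ (Fin p) → Ξ → ℝ
  /-- The law of one exogenous disturbance. -/
  noise : Measure Ξ
  /-- The discount factor. -/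
  γ : ℝ
  isProb : IsProbabilityMeasure noise
  γ_pos : 0 < γ
  γ_lt_one : γ < 1
  f_mem : ∀ s ∈ states, ∀ x, ∀ b ∈ feasible x, ∀ ξ, f s x b ξ ∈ states
  f_meas : ∀ x, Measurable fun z : (EuclideanSpace ℝ (Fin d) × EuclideanSpace ℝ (Fin p)) × Ξ =>
    f z.1.1 x z.1.2 z.2
  c_meas : ∀ x, Measurable fun z : (EuclideanSpace ℝ (Fin d) × EuclideanSpace ℝ (Fin p)) × Ξ =>
    c z.1.1 x z.1.2 z.2

/-- A parametrized hybrid policy: a stochastic discrete policy `disc φ s x = π^X_φ(x ∣ s)` and a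
deterministic continuous policy `cont κ s x = b_κ(s, x)`, the candidate applied when the discrete
action `x` is drawn. -/
structure HybridPolicy {X Ξ : Type*} [Fintype X] [MeasurableSpace X] [DiscreteMeasurableSpace X]
    [MeasurableSpace Ξ] {d p : ℕ} (M : HybridMDP X Ξ d p) (m n : ℕ) where
  disc : EuclideanSpace ℝ (Fin m) → EuclideanSpace ℝ (Fin d) → X → ℝ
  cont : EuclideanSpace ℝ (Fin n) → EuclideanSpace ℝ (Fin d) → X → EuclideanSpace ℝ (Fin p)
  disc_nonneg : ∀ φ s x, 0 ≤ disc φ s x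
  disc_sum : ∀ φ s, ∑ x, disc φ s x = 1
  disc_meas : ∀ φ x, Measurable fun s => disc φ s x
  cont_mem : ∀ κ, ∀ s ∈ M.states, ∀ x, cont κ s x ∈ M.feasible x
  cont_meas : ∀ κ x, Measurable fun s => cont κ s x

namespace HybridMDP

variable {X Ξ : Type*} [Fintype X] [MeasurableSpace X] [DiscreteMeasurableSpace X]
  [MeasurableSpace Ξ] {d p : ℕ} (M : HybridMDP X Ξ d p)

instance : IsProbabilityMeasure M.noise := M.isProb

/-- The law of the exogenous scenario `ξ_{0:∞}`. -/
def scenarioLaw : Measure (ℕ → Ξ) := Measure.infinitePi fun _ : ℕ => M.noise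

/-- For every discrete action `x` and realization `ξ`, the maps `(s, b) ↦ f(s, (x, b), ξ)` and
`(s, b) ↦ c(s, (x, b), ξ)` are continuous and almost everywhere differentiable. -/
structure SmoothDynamics : Prop where
  f_cont : ∀ x ξ, ContinuousOn (fun z => M.f z.1 x z.2 ξ) (M.states ×ˢ M.feasible x)
  f_diff : ∀ x ξ, ∀ᵐ z : EuclideanSpace ℝ (Fin d) × EuclideanSpace ℝ (Fin p),
    z ∈ M.states ×ˢ M.feasible x →
      DifferentiableWithinAt ℝ (fun z => M.f z.1 x z.2 ξ) (M.states ×ˢ M.feasible x) z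
  c_cont : ∀ x ξ, ContinuousOn (fun z => M.c z.1 x z.2 ξ) (M.states ×ˢ M.feasible x)
  c_diff : ∀ x ξ, ∀ᵐ z : EuclideanSpace ℝ (Fin d) × EuclideanSpace ℝ (Fin p),
    z ∈ M.states ×ˢ M.feasible x →
      DifferentiableWithinAt ℝ (fun z => M.c z.1 x z.2 ξ) (M.states ×ˢ M.feasible x) z

end HybridMDP

namespace HybridPolicy

variable {X Ξ : Type*} [Fintype X] [MeasurableSpace X] [DiscreteMeasurableSpace X]
  [MeasurableSpace Ξ] {d p : ℕ} {M : HybridMDP X Ξ d p} {m n : ℕ} (P : HybridPolicy M m n)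

/-- The realized state `s_t(κ)`, for a fixed realization `ω = (x_t, ξ_t)_t`. -/
def state (κ : EuclideanSpace ℝ (Fin n)) (s₀ : EuclideanSpace ℝ (Fin d)) (ω : ℕ → X × Ξ) :
    ℕ → EuclideanSpace ℝ (Fin d)
  | 0 => s₀
  | t + 1 => M.f (state κ s₀ ω t) (ω t).1 (P.cont κ (state κ s₀ ω t) (ω t).1) (ω t).2

/-- The realized continuous action `b_t(κ) = b_κ(s_t(κ), x_t)`. -/
def action (κ : EuclideanSpace ℝ (Fin n)) (s₀ : EuclideanSpace ℝ (Fin d)) (ω : ℕ → X × Ξ)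
    (t : ℕ) : EuclideanSpace ℝ (Fin p) :=
  P.cont κ (P.state κ s₀ ω t) (ω t).1

/-- The realized cost `c_t(κ) = c(s_t(κ), (x_t, b_t(κ)), ξ_t)`. -/
def cost (κ : EuclideanSpace ℝ (Fin n)) (s₀ : EuclideanSpace ℝ (Fin d)) (ω : ℕ → X × Ξ)
    (t : ℕ) : ℝ :=
  M.c (P.state κ s₀ ω t) (ω t).1 (P.action κ s₀ ω t) (ω t).2

/-- The realized probability `π^X_φ(x_t ∣ s_t(κ))`. -/
def prob (φ : EuclideanSpace ℝ (Fin m)) (κ : EuclideanSpace ℝ (Fin n))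
    (s₀ : EuclideanSpace ℝ (Fin d)) (ω : ℕ → X × Ξ) (t : ℕ) : ℝ :=
  P.disc φ (P.state κ s₀ ω t) (ω t).1

/-- The realized log-probability `log π^X_φ(x_t ∣ s_t(κ))`. -/
def logProb (φ : EuclideanSpace ℝ (Fin m)) (κ : EuclideanSpace ℝ (Fin n))
    (s₀ : EuclideanSpace ℝ (Fin d)) (ω : ℕ → X × Ξ) (t : ℕ) : ℝ :=
  Real.log (P.prob φ κ s₀ ω t)

/-! ### The joint law of discrete actions and noise -/

/-- The discrete policy `π^X_φ(· ∣ s)` as a Markov kernel. -/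
def discKernel (φ : EuclideanSpace ℝ (Fin m)) : Kernel (EuclideanSpace ℝ (Fin d)) X where
  toFun s := ∑ x, ENNReal.ofReal (P.disc φ s x) • Measure.dirac x
  measurable' := by
    refine Measure.measurable_of_measurable_coe _ fun A _ => ?_
    simp only [Measure.coe_finsetSum, Finset.sum_apply, Measure.smul_apply, smul_eq_mul]
    exact Finset.measurable_sum _ fun x _ => ((P.disc_meas φ x).ennreal_ofReal).mul_const _

instance (φ : EuclideanSpace ℝ (Fin m)) : IsMarkovKernel (P.discKernel φ) := by
  refine ⟨fun s => ⟨?_⟩⟩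
  change (∑ x, ENNReal.ofReal (P.disc φ s x) • Measure.dirac x : Measure X) Set.univ = 1
  simp only [Measure.coe_finsetSum, Finset.sum_apply, Measure.smul_apply, smul_eq_mul,
    measure_univ, mul_one]
  rw [← ENNReal.ofReal_sum_of_nonneg fun x _ => P.disc_nonneg φ s x, P.disc_sum,
    ENNReal.ofReal_one]

/-- From a state `s`, draw the discrete action from `π^X_φ(· ∣ s)` and, independently, the noise. -/
def stepKernel (φ : EuclideanSpace ℝ (Fin m)) : Kernel (EuclideanSpace ℝ (Fin d)) (X × Ξ) :=
  P.discKernel φ ×ₖ Kernel.const _ M.noise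

instance (φ : EuclideanSpace ℝ (Fin m)) : IsMarkovKernel (P.stepKernel φ) := by
  unfold stepKernel; infer_instance

/-- Prolong a history up to time `t` to an infinite sequence, in an arbitrary way. -/
def prolong {α : Type*} (t : ℕ) (h : (i : Finset.Iic t) → α) (i : ℕ) : α :=
  h ⟨min i t, Finset.mem_Iic.2 (min_le_right i t)⟩

theorem measurable_state (κ : EuclideanSpace ℝ (Fin n)) (s₀ : EuclideanSpace ℝ (Fin d)) (t : ℕ) :
    Measurable fun ω : ℕ → X × Ξ => P.state κ s₀ ω t := by
  induction t with
  | zero => exact measurable_const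
  | succ t ih =>
    have hb : Measurable fun z : X × EuclideanSpace ℝ (Fin d) => P.cont κ z.2 z.1 :=
      measurable_from_prod_countable_right fun x => P.cont_meas κ x
    have hf : Measurable fun z : X ×
        ((EuclideanSpace ℝ (Fin d) × EuclideanSpace ℝ (Fin p)) × Ξ) =>
        M.f z.2.1.1 z.1 z.2.1.2 z.2.2 :=
      measurable_from_prod_countable_right fun x => M.f_meas x
    have hx : Measurable fun ω : ℕ → X × Ξ => (ω t).1 := (measurable_pi_apply t).fst
    have hξ : Measurable fun ω : ℕ → X × Ξ => (ω t).2 := (measurable_pi_apply t).snd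
    exact hf.comp (hx.prodMk ((ih.prodMk (hb.comp (hx.prodMk ih))).prodMk hξ))

/-- The state `s_{t+1}(κ)` reached after the history `(x_{0:t}, ξ_{0:t})`. -/
def nextState (κ : EuclideanSpace ℝ (Fin n)) (s₀ : EuclideanSpace ℝ (Fin d)) (t : ℕ)
    (h : (i : Finset.Iic t) → X × Ξ) : EuclideanSpace ℝ (Fin d) :=
  P.state κ s₀ (prolong t h) (t + 1)

theorem measurable_nextState (κ : EuclideanSpace ℝ (Fin n)) (s₀ : EuclideanSpace ℝ (Fin d))
    (t : ℕ) : Measurable (P.nextState κ s₀ t) :=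
  (P.measurable_state κ s₀ (t + 1)).comp
    (measurable_pi_lambda _ fun _ => measurable_pi_apply _)

/-- The law `D_θ`, `θ = (φ, κ)`, of `(x_t, ξ_t)_{t ≥ 0}` when the system starts in `s₀`: given the
history `(x_{0:t}, ξ_{0:t})`, the action `x_{t+1}` is drawn from `π^X_φ(· ∣ s_{t+1}(κ))` and
`ξ_{t+1}` is an independent noise variable. -/
def law (φ : EuclideanSpace ℝ (Fin m)) (κ : EuclideanSpace ℝ (Fin n))
    (s₀ : EuclideanSpace ℝ (Fin d)) : Measure (ℕ → X × Ξ) :=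
  Kernel.trajMeasure (X := fun _ => X × Ξ) (P.stepKernel φ s₀)
    fun t => (P.stepKernel φ).comap (P.nextState κ s₀ t) (P.measurable_nextState κ s₀ t)

/-- The objective `J(φ, κ) = E_θ[∑ γ^t c_t(κ) ∣ s₀]`. -/
def J (s₀ : EuclideanSpace ℝ (Fin d)) (φ : EuclideanSpace ℝ (Fin m))
    (κ : EuclideanSpace ℝ (Fin n)) : ℝ :=
  ∫ ω, ∑' t, M.γ ^ t * P.cost κ s₀ ω t ∂(P.law φ κ s₀)

/-- The action-value function `Q_{π_θ}(s, (x, b))`: the expected discounted cost when the action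
`(x, b)` is taken in the state `s` and the policy `π_θ` is followed afterwards. -/
def Q (φ : EuclideanSpace ℝ (Fin m)) (κ : EuclideanSpace ℝ (Fin n))
    (s : EuclideanSpace ℝ (Fin d)) (x : X) (b : EuclideanSpace ℝ (Fin p)) : ℝ :=
  ∫ ξ, ∫ ω, (M.c s x b ξ + ∑' t, M.γ ^ (t + 1) * P.cost κ (M.f s x b ξ) ω t)
    ∂(P.law φ κ (M.f s x b ξ)) ∂M.noise

/-! ### Regularity of the policy -/

/-- Pair a sequence of discrete actions with a scenario. -/
def realization (x : ℕ → X) (ξ : ℕ → Ξ) : ℕ → X × Ξ := fun t => (x t, ξ t)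

/-- Regularity of the policy, for the initial state `s₀`. -/
structure Regular (s₀ : EuclideanSpace ℝ (Fin d)) : Prop where
  disc_cont : ∀ φ x, ContinuousOn (fun s => P.disc φ s x) M.states
  disc_diff : ∀ φ x, ∀ᵐ s, s ∈ M.states →
    DifferentiableWithinAt ℝ (fun s => P.disc φ s x) M.states s
  cont_cont : ∀ s ∈ M.states, ∀ x, Continuous fun κ => P.cont κ s x
  cont_diff : ∀ s ∈ M.states, ∀ x, ∀ᵐ κ, DifferentiableAt ℝ (fun κ => P.cont κ s x) κ
  /-- At each `(φ, κ)`, for almost every scenario, the gradients `∇_φ log π^X_φ(x_t ∣ s_t(κ))`,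
  `∇_κ log π^X_φ(x_t ∣ s_t(κ))` and `∇_κ c_t(κ)` exist for all `t` and all discrete sequences. -/
  grad_exists : ∀ φ κ, ∀ᵐ ξ ∂M.scenarioLaw, ∀ (x : ℕ → X) (t : ℕ),
    DifferentiableAt ℝ (fun φ' => P.logProb φ' κ s₀ (realization x ξ) t) φ ∧
    DifferentiableAt ℝ (fun κ' => P.logProb φ κ' s₀ (realization x ξ) t) κ ∧
    DifferentiableAt ℝ (fun κ' => P.cost κ' s₀ (realization x ξ) t) κ
  /-- These gradients are bounded near each `(φ, κ)`, uniformly in `t`, in the scenario and in the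
  discrete sequence, in the sense that the functions are Lipschitz with a uniform constant; the
  probabilities inside the logarithms are positive. -/
  grad_bounded : ∀ φ κ, ∃ r > 0, ∃ L : NNReal, ∀ᵐ ξ ∂M.scenarioLaw, ∀ (x : ℕ → X) (t : ℕ),
    (∀ φ' ∈ Metric.ball φ r, ∀ κ' ∈ Metric.ball κ r,
      0 < P.prob φ' κ' s₀ (realization x ξ) t) ∧
    (∀ κ' ∈ Metric.ball κ r, LipschitzOnWith L
      (fun φ' => P.logProb φ' κ' s₀ (realization x ξ) t) (Metric.ball φ r)) ∧
    (∀ φ' ∈ Metric.ball φ r, LipschitzOnWith L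
      (fun κ' => P.logProb φ' κ' s₀ (realization x ξ) t) (Metric.ball κ r)) ∧
    LipschitzOnWith L (fun κ' => P.cost κ' s₀ (realization x ξ) t) (Metric.ball κ r)
  cost_bounded : ∃ C : ℝ, ∀ s ∈ M.states, ∀ x, ∀ b ∈ M.feasible x, ∀ ξ, |M.c s x b ξ| ≤ C

/-- At `(φ, κ)`, for almost every scenario, the log-probabilities are differentiable jointly in the
two parameters. -/
def JointlyDifferentiable (s₀ : EuclideanSpace ℝ (Fin d)) (φ : EuclideanSpace ℝ (Fin m))
    (κ : EuclideanSpace ℝ (Fin n)) : Prop :=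
  ∀ᵐ ξ ∂M.scenarioLaw, ∀ (x : ℕ → X) (t : ℕ),
    DifferentiableAt ℝ
      (fun θ : EuclideanSpace ℝ (Fin m) × EuclideanSpace ℝ (Fin n) =>
        P.logProb θ.1 θ.2 s₀ (realization x ξ) t) (φ, κ)

/-! ### The terms of the estimator -/

/-- `γ^t ∇_φ log π^X_φ(x_t ∣ s_t(κ)) Q_{π_θ}(s_t(κ), a_t)`. -/
def scoreTerm (s₀ : EuclideanSpace ℝ (Fin d)) (φ : EuclideanSpace ℝ (Fin m))
    (κ : EuclideanSpace ℝ (Fin n)) (ω : ℕ → X × Ξ) (t : ℕ) : EuclideanSpace ℝ (Fin m) :=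
  (M.γ ^ t * P.Q φ κ (P.state κ s₀ ω t) (ω t).1 (P.action κ s₀ ω t)) •
    ∇ (fun φ' => P.logProb φ' κ s₀ ω t) φ

/-- `γ^t ∇_κ c(s_t(κ), (x_t, b_t(κ)), ξ_t)`. -/
def pathwiseTerm (s₀ : EuclideanSpace ℝ (Fin d)) (κ : EuclideanSpace ℝ (Fin n))
    (ω : ℕ → X × Ξ) (t : ℕ) : EuclideanSpace ℝ (Fin n) :=
  M.γ ^ t • ∇ (fun κ' => P.cost κ' s₀ ω t) κ

/-- `γ^t ∇_κ log π^X_φ(x_t ∣ s_t(κ)) Q_{π_θ}(s_t(κ), a_t)`. -/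
def crossTerm (s₀ : EuclideanSpace ℝ (Fin d)) (φ : EuclideanSpace ℝ (Fin m))
    (κ : EuclideanSpace ℝ (Fin n)) (ω : ℕ → X × Ξ) (t : ℕ) : EuclideanSpace ℝ (Fin n) :=
  (M.γ ^ t * P.Q φ κ (P.state κ s₀ ω t) (ω t).1 (P.action κ s₀ ω t)) •
    ∇ (fun κ' => P.logProb φ κ' s₀ ω t) κ

end HybridPolicy

/-- The random series `∑ F ω t` converges absolutely for `μ`-almost every `ω` and its sum is
`μ`-integrable, so that `E[∑ F]` is a genuine expectation. -/
def SeriesIntegrable {Ω E : Type*} [MeasurableSpace Ω] [NormedAddCommGroup E]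
    (μ : Measure Ω) (F : Ω → ℕ → E) : Prop :=
  (∀ᵐ ω ∂μ, Summable fun t => ‖F ω t‖) ∧ Integrable (fun ω => ∑' t, F ω t) μ

end

/-!
The law of the process depends on the parameters, so the expectation cannot be differentiated under
its integral sign directly. On events involving only the first `t` time steps, however, the law has
the density `∏_{i<t} |X| π_φ(x_i ∣ s_i(κ))` with respect to a fixed reference measure, under which
the discrete actions are uniform and everything is independent
(`HybridPolicy.integral_law_eq_integral_weight`). Hence
`g_t = E_θ[c_t] = ∫ (∏_{i≤t} |X| π_φ(x_i ∣ s_i(κ))) c_t(κ)` is an integral with respect to a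
parameter-free measure and can be differentiated by dominated convergence; the derivative is
`E_θ[∇c_t] + ∑_{i≤t} E_θ[∇(log π_i) c_t]`
(`HybridPolicy.exists_hasFDerivAt_integral_cost`).

To sum over `t`, the Lipschitz constants of `γ^t g_t` must be summable, while the crude bound
`|X|^t` on the density may grow faster than `γ^{-t}`. As `|e^a - e^b| ≤ (e^a + e^b) |a - b|`, the
increment
of the density is at most the sum of two densities, whose integral is `2`, times the increment of a
sum of `t + 1` Lipschitz functions; so the Lipschitz constant of `g_t` grows only linearly in `t`
(`HybridPolicy.abs_integral_cost_sub_le`). Dominated convergence for the counting measure on `ℕ`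
then differentiates `J = ∑ γ^t g_t` term by term (`hasFDerivAt_tsum_of_lipschitzOn`).

The score of `x_i` is a function of `ω_{<i}` and `x_i`, so that in `E_θ[∇(log π_i) c_{i+k}]` the
cost may be replaced by its conditional expectation given `s_i` and `x_i`
(`HybridPolicy.integral_mul_cost_eq`), and the discounted sum over `k` of these conditional
expectations is the action-value function (`HybridPolicy.hasSum_Q`). Exchanging the summations over
`i` and `t = i + k` turns the double series into `∑_i γ^i E_θ[∇(log π_i) Q(s_i, a_i)]`.

All of this is carried out for an arbitrary family of parameters `e ↦ (Φ e, K e)`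
(`HybridPolicy.exists_hasFDerivAt_J`), with the families `φ ↦ (φ, κ)`, `κ ↦ (φ, κ)` and
`θ ↦ θ` giving the two gradients and joint differentiability. The hypotheses concern almost every
scenario `ξ`; they hold for almost every realization, under the law of any policy, because the noise
component of the process always has the scenario law (`HybridPolicy.map_snd_law`).
-/

noncomputable section

namespace HybridPolicy

variable {X Ξ : Type*} [Fintype X] [MeasurableSpace X] [DiscreteMeasurableSpace X]
  [MeasurableSpace Ξ] {d p : ℕ} {M : HybridMDP X Ξ d p} {m n : ℕ} (P : HybridPolicy M m n)

/-! ### Trajectories -/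

theorem state_mem {s₀ : EuclideanSpace ℝ (Fin d)} (hs₀ : s₀ ∈ M.states)
    (κ : EuclideanSpace ℝ (Fin n)) (ω : ℕ → X × Ξ) (t : ℕ) : P.state κ s₀ ω t ∈ M.states := by
  induction t with
  | zero => exact hs₀
  | succ t ih => exact M.f_mem _ ih _ _ (P.cont_mem κ _ ih _) _

theorem state_congr (κ : EuclideanSpace ℝ (Fin n)) (s₀ : EuclideanSpace ℝ (Fin d))
    {ω ω' : ℕ → X × Ξ} {t : ℕ} (h : ∀ i < t, ω i = ω' i) :
    P.state κ s₀ ω t = P.state κ s₀ ω' t := by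
  induction t with
  | zero => rfl
  | succ t ih =>
    simp only [state, ih fun i hi => h i (hi.trans t.lt_succ_self), h t t.lt_succ_self]

theorem prob_congr (φ : EuclideanSpace ℝ (Fin m)) (κ : EuclideanSpace ℝ (Fin n))
    (s₀ : EuclideanSpace ℝ (Fin d)) {ω ω' : ℕ → X × Ξ} {t : ℕ} (h : ∀ i < t, ω i = ω' i)
    (hx : (ω t).1 = (ω' t).1) : P.prob φ κ s₀ ω t = P.prob φ κ s₀ ω' t := by
  simp only [prob, P.state_congr κ s₀ h, hx]

theorem cost_congr (κ : EuclideanSpace ℝ (Fin n)) (s₀ : EuclideanSpace ℝ (Fin d))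
    {ω ω' : ℕ → X × Ξ} {t : ℕ} (h : ∀ i < t + 1, ω i = ω' i) :
    P.cost κ s₀ ω t = P.cost κ s₀ ω' t := by
  simp only [cost, action, P.state_congr κ s₀ fun i hi => h i (hi.trans t.lt_succ_self),
    h t t.lt_succ_self]

theorem state_update (κ : EuclideanSpace ℝ (Fin n)) (s₀ : EuclideanSpace ℝ (Fin d))
    (ω : ℕ → X × Ξ) (t : ℕ) (y : X × Ξ) :
    P.state κ s₀ (Function.update ω t y) t = P.state κ s₀ ω t :=
  P.state_congr κ s₀ fun _ hi => Function.update_of_ne hi.ne _ _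

theorem measurable_contAction (κ : EuclideanSpace ℝ (Fin n)) :
    Measurable fun z : X × EuclideanSpace ℝ (Fin d) => P.cont κ z.2 z.1 :=
  measurable_from_prod_countable_right fun x => P.cont_meas κ x

theorem measurable_prob (φ : EuclideanSpace ℝ (Fin m)) (κ : EuclideanSpace ℝ (Fin n))
    (s₀ : EuclideanSpace ℝ (Fin d)) (t : ℕ) : Measurable fun ω => P.prob φ κ s₀ ω t := by
  have h : Measurable fun z : X × EuclideanSpace ℝ (Fin d) => P.disc φ z.2 z.1 :=
    measurable_from_prod_countable_right fun x => P.disc_meas φ x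
  exact h.comp (((measurable_pi_apply t).fst).prodMk (P.measurable_state κ s₀ t))

theorem measurable_cost (κ : EuclideanSpace ℝ (Fin n)) (s₀ : EuclideanSpace ℝ (Fin d)) (t : ℕ) :
    Measurable fun ω => P.cost κ s₀ ω t := by
  have hc : Measurable fun z : X ×
      ((EuclideanSpace ℝ (Fin d) × EuclideanSpace ℝ (Fin p)) × Ξ) =>
      M.c z.2.1.1 z.1 z.2.1.2 z.2.2 :=
    measurable_from_prod_countable_right fun x => M.c_meas x
  have hx : Measurable fun ω : ℕ → X × Ξ => (ω t).1 := (measurable_pi_apply t).fst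
  have hξ : Measurable fun ω : ℕ → X × Ξ => (ω t).2 := (measurable_pi_apply t).snd
  have hs := P.measurable_state κ s₀ t
  exact hc.comp (hx.prodMk ((hs.prodMk ((P.measurable_contAction κ).comp (hx.prodMk hs))).prodMk
    hξ))

theorem prob_nonneg (φ : EuclideanSpace ℝ (Fin m)) (κ : EuclideanSpace ℝ (Fin n))
    (s₀ : EuclideanSpace ℝ (Fin d)) (ω : ℕ → X × Ξ) (t : ℕ) : 0 ≤ P.prob φ κ s₀ ω t :=
  P.disc_nonneg _ _ _

theorem disc_le_one (φ : EuclideanSpace ℝ (Fin m)) (s : EuclideanSpace ℝ (Fin d)) (x : X) :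
    P.disc φ s x ≤ 1 := by
  rw [← P.disc_sum φ s]
  exact Finset.single_le_sum (f := P.disc φ s) (fun y _ => P.disc_nonneg φ s y)
    (Finset.mem_univ x)

theorem abs_sum_disc_mul_le (φ : EuclideanSpace ℝ (Fin m)) (s : EuclideanSpace ℝ (Fin d))
    {a : X → ℝ} {C : ℝ} (ha : ∀ x, |a x| ≤ C) : |∑ x, P.disc φ s x * a x| ≤ C :=
  calc _ ≤ ∑ x, |P.disc φ s x * a x| := Finset.abs_sum_le_sum_abs _ _
    _ ≤ ∑ x, P.disc φ s x * C := Finset.sum_le_sum fun x _ => by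
        rw [abs_mul, abs_of_nonneg (P.disc_nonneg _ _ _)]
        exact mul_le_mul_of_nonneg_left (ha x) (P.disc_nonneg _ _ _)
    _ = C := by rw [← Finset.sum_mul, P.disc_sum, one_mul]

theorem abs_cost_le {C : ℝ}
    (hC : ∀ s ∈ M.states, ∀ x, ∀ b ∈ M.feasible x, ∀ ξ, |M.c s x b ξ| ≤ C)
    {s₀ : EuclideanSpace ℝ (Fin d)} (hs₀ : s₀ ∈ M.states) (κ : EuclideanSpace ℝ (Fin n))
    (ω : ℕ → X × Ξ) (t : ℕ) : |P.cost κ s₀ ω t| ≤ C :=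
  hC _ (P.state_mem hs₀ κ ω t) _ _ (P.cont_mem κ _ (P.state_mem hs₀ κ ω t) _) _

/-! ### One step of the law of the process -/

instance (φ : EuclideanSpace ℝ (Fin m)) (κ : EuclideanSpace ℝ (Fin n))
    (s₀ : EuclideanSpace ℝ (Fin d)) : IsProbabilityMeasure (P.law φ κ s₀) := by
  unfold law; infer_instance

theorem prolong_frestrictLe_apply {α : Type*} (ω : ℕ → α) {t i : ℕ} (hi : i ≤ t) :
    prolong t (Preorder.frestrictLe (π := fun _ => α) t ω) i = ω i := by
  simp [prolong, min_eq_left hi]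

theorem nextState_frestrictLe (κ : EuclideanSpace ℝ (Fin n)) (s₀ : EuclideanSpace ℝ (Fin d))
    (ω : ℕ → X × Ξ) (t : ℕ) :
    P.nextState κ s₀ t (Preorder.frestrictLe (π := fun _ => X × Ξ) t ω)
      = P.state κ s₀ ω (t + 1) :=
  P.state_congr κ s₀ fun _ hi => prolong_frestrictLe_apply ω (Nat.lt_succ_iff.1 hi)

theorem map_eval_zero_law (φ : EuclideanSpace ℝ (Fin m)) (κ : EuclideanSpace ℝ (Fin n))
    (s₀ : EuclideanSpace ℝ (Fin d)) :
    (P.law φ κ s₀).map (fun ω => ω 0) = P.stepKernel φ s₀ := by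
  have h : (fun ω : ℕ → X × Ξ => ω 0) = (fun h : (i : Finset.Iic 0) → X × Ξ =>
      h ⟨0, by simp⟩) ∘ (Preorder.frestrictLe (π := fun _ => X × Ξ) 0) := rfl
  rw [h, ← Measure.map_map (by fun_prop) (by fun_prop), law, Kernel.trajMeasure,
    Measure.map_comp _ _ (by fun_prop), Kernel.traj_map_frestrictLe, Kernel.partialTraj_self,
    Measure.id_comp, Measure.map_map (by fun_prop) (by fun_prop)]
  convert Measure.map_id using 2
  rfl

/-- At time `0` the law of `(x_0, ξ_0)` is the initial law of `Kernel.trajMeasure`; at later times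
its defining kernels apply. -/
theorem integral_law_eq_stepKernel (φ : EuclideanSpace ℝ (Fin m)) (κ : EuclideanSpace ℝ (Fin n))
    (s₀ : EuclideanSpace ℝ (Fin d)) {t : ℕ} {F : (ℕ → X × Ξ) → ℝ} (hF : Measurable F) {C : ℝ}
    (hC : ∀ ω, |F ω| ≤ C) (hdep : DependsOn F (Set.Iio (t + 1))) :
    ∫ ω, F ω ∂P.law φ κ s₀ = ∫ ω, ∫ y, F (Function.update ω t y)
      ∂P.stepKernel φ (P.state κ s₀ ω t) ∂P.law φ κ s₀ := by
  cases t with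
  | zero =>
    have key : ∀ ω₁ : ℕ → X × Ξ, ∫ y, F (Function.update ω₁ 0 y) ∂P.stepKernel φ s₀
        = ∫ ω, F ω ∂P.law φ κ s₀ := fun ω₁ => by
      rw [← P.map_eval_zero_law φ κ s₀, integral_map (measurable_pi_apply 0).aemeasurable]
      · refine integral_congr_ae (.of_forall fun ω => hdep fun i hi => ?_)
        obtain rfl : i = 0 := by simpa using hi
        simp
      · exact (hF.comp (measurable_update ω₁)).aestronglyMeasurable
    simp only [state, key]
    simp
  | succ t =>
    let k : (t : ℕ) → Kernel ((i : Finset.Iic t) → X × Ξ) (X × Ξ) := fun t =>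
      (P.stepKernel φ).comap (P.nextState κ s₀ t) (P.measurable_nextState κ s₀ t)
    have hmap := Kernel.map_frestrictLe_trajMeasure_compProd_eq_map_trajMeasure
      (X := fun _ => X × Ξ) (μ₀ := P.stepKernel φ s₀) (κ := k) (a := t)
    change (P.law φ κ s₀).map _ ⊗ₘ _ = (P.law φ κ s₀).map _ at hmap
    let G : ((i : Finset.Iic t) → X × Ξ) × (X × Ξ) → ℝ := fun z =>
      F (Function.update (prolong t z.1) (t + 1) z.2)
    have hG : Measurable G := by
      refine hF.comp ?_
      refine measurable_pi_lambda _ fun i => ?_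
      by_cases hi : i = t + 1
      · subst hi; simpa using measurable_snd
      · simp only [Function.update_of_ne hi, prolong]
        fun_prop
    have hres : Measurable (Preorder.frestrictLe (π := fun _ => X × Ξ) t) := by fun_prop
    have hGF : ∀ (ω : ℕ → X × Ξ) y,
        G (Preorder.frestrictLe (π := fun _ => X × Ξ) t ω, y)
          = F (Function.update ω (t + 1) y) := fun ω y => hdep fun i hi => by
      rcases eq_or_ne i (t + 1) with rfl | hne
      · simp
      · simp only [Function.update_of_ne hne]
        exact prolong_frestrictLe_apply ω (by simp only [Set.mem_Iio] at hi; omega)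
    calc ∫ ω, F ω ∂P.law φ κ s₀
        = ∫ ω, G (Preorder.frestrictLe (π := fun _ => X × Ξ) t ω, ω (t + 1)) ∂P.law φ κ s₀ := by
          simp only [hGF, Function.update_eq_self]
      _ = ∫ z, G z ∂((P.law φ κ s₀).map
            (Preorder.frestrictLe (π := fun _ => X × Ξ) t) ⊗ₘ k t) := by
          rw [hmap, integral_map (by fun_prop) hG.aestronglyMeasurable]
      _ = ∫ h, ∫ y, G (h, y) ∂k t h ∂(P.law φ κ s₀).map
            (Preorder.frestrictLe (π := fun _ => X × Ξ) t) := by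
          have : IsProbabilityMeasure ((P.law φ κ s₀).map
            (Preorder.frestrictLe (π := fun _ => X × Ξ) t)) :=
              Measure.isProbabilityMeasure_map hres.aemeasurable
          refine Measure.integral_compProd (Integrable.of_bound hG.aestronglyMeasurable C
            (.of_forall fun z => hC _))
      _ = _ := by
          rw [integral_map hres.aemeasurable]
          · simp only [hGF, k, Kernel.comap_apply, nextState_frestrictLe]
          · exact hG.stronglyMeasurable.integral_kernel_prod_right.aestronglyMeasurable

theorem integral_stepKernel (φ : EuclideanSpace ℝ (Fin m)) (s : EuclideanSpace ℝ (Fin d))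
    {F : X × Ξ → ℝ} (hF : Measurable F) {C : ℝ} (hC : ∀ y, |F y| ≤ C) :
    ∫ y, F y ∂P.stepKernel φ s = ∑ x, P.disc φ s x * ∫ ξ, F (x, ξ) ∂M.noise := by
  rw [stepKernel, Kernel.prod_apply, Kernel.const_apply,
    integral_prod _ (Integrable.of_bound hF.aestronglyMeasurable C (.of_forall hC))]
  change ∫ x, _ ∂(∑ x, ENNReal.ofReal (P.disc φ s x) • Measure.dirac x) = _
  rw [integral_finsetSum_measure]
  · refine Finset.sum_congr rfl fun x _ => ?_
    rw [integral_smul_measure, integral_dirac, ENNReal.toReal_ofReal (P.disc_nonneg φ s x),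
      smul_eq_mul]
  · exact fun x _ => (integrable_dirac (by simp)).smul_measure ENNReal.ofReal_ne_top

/-- Conditioning on the history before time `t`: the pair `(x_t, ξ_t)` of a function of the first
`t + 1` coordinates is replaced by its conditional law. -/
theorem integral_law_eq_sum (φ : EuclideanSpace ℝ (Fin m)) (κ : EuclideanSpace ℝ (Fin n))
    (s₀ : EuclideanSpace ℝ (Fin d)) {t : ℕ} {F : (ℕ → X × Ξ) → ℝ} (hF : Measurable F) {C : ℝ}
    (hC : ∀ ω, |F ω| ≤ C) (hdep : DependsOn F (Set.Iio (t + 1))) :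
    ∫ ω, F ω ∂P.law φ κ s₀ = ∫ ω, ∑ x, P.disc φ (P.state κ s₀ ω t) x *
      ∫ ξ, F (Function.update ω t (x, ξ)) ∂M.noise ∂P.law φ κ s₀ := by
  rw [P.integral_law_eq_stepKernel φ κ s₀ hF hC hdep]
  refine integral_congr_ae (.of_forall fun ω => ?_)
  exact P.integral_stepKernel φ _ (hF.comp (measurable_update ω)) fun y => hC _

end HybridPolicy

/-! ### Bounded integrands and random series -/

theorem abs_integral_le_of_abs_le {Ω : Type*} [MeasurableSpace Ω] {μ : Measure Ω}
    [IsProbabilityMeasure μ] {f : Ω → ℝ} {C : ℝ} (hf : ∀ ω, |f ω| ≤ C) : |∫ ω, f ω ∂μ| ≤ C := by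
  have h := norm_integral_le_of_norm_le_const (μ := μ) (f := f) (C := C) (.of_forall hf)
  rwa [probReal_univ, mul_one] at h

/-- A random series with a summable deterministic bound may be integrated term by term. -/
theorem SeriesIntegrable.of_norm_le {Ω E : Type*} [MeasurableSpace Ω] [NormedAddCommGroup E]
    [NormedSpace ℝ E] [CompleteSpace E] {μ : Measure Ω} [IsFiniteMeasure μ] {F : Ω → ℕ → E}
    {b : ℕ → ℝ} (hF : ∀ t, AEStronglyMeasurable (fun ω => F ω t) μ)
    (hb : ∀ᵐ ω ∂μ, ∀ t, ‖F ω t‖ ≤ b t) (hsum : Summable b) :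
    SeriesIntegrable μ F ∧ HasSum (fun t => ∫ ω, F ω t ∂μ) (∫ ω, ∑' t, F ω t ∂μ) := by
  have hs : ∀ᵐ ω ∂μ, Summable fun t => ‖F ω t‖ := by
    filter_upwards [hb] with ω h
    exact Summable.of_nonneg_of_le (fun _ => norm_nonneg _) h hsum
  refine ⟨⟨hs, Integrable.of_bound (C := ∑' t, b t) ?_ ?_⟩, ?_⟩
  · refine aestronglyMeasurable_of_tendsto_ae Filter.atTop
      (f := fun N ω => ∑ t ∈ Finset.range N, F ω t)
      (fun N => Finset.aestronglyMeasurable_fun_sum _ fun t _ => hF t) ?_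
    filter_upwards [hs] with ω h
    exact h.of_norm.hasSum.tendsto_sum_nat
  · filter_upwards [hb, hs] with ω h h'
    exact (norm_tsum_le_tsum_norm h').trans (h'.tsum_le_tsum h hsum)
  · refine hasSum_integral_of_dominated_convergence (fun t _ => b t) hF
      (fun t => hb.mono fun ω h => h t) (.of_forall fun _ => hsum) (integrable_const _) ?_
    filter_upwards [hs] with ω h
    exact h.of_norm.hasSum

namespace HybridPolicy

variable {X Ξ : Type*} [Fintype X] [MeasurableSpace X] [DiscreteMeasurableSpace X]
  [MeasurableSpace Ξ] {d p : ℕ} {M : HybridMDP X Ξ d p} {m n : ℕ} (P : HybridPolicy M m n)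

/-! ### The law of the scenario -/

theorem integral_law_prod_noise (φ : EuclideanSpace ℝ (Fin m)) (κ : EuclideanSpace ℝ (Fin n))
    (s₀ : EuclideanSpace ℝ (Fin d)) {u : ℕ → Ξ → ℝ} (hu : ∀ i, Measurable (u i))
    (hu1 : ∀ i ξ, |u i ξ| ≤ 1) (N : ℕ) :
    ∫ ω, ∏ i ∈ Finset.range N, u i (ω i).2 ∂P.law φ κ s₀
      = ∏ i ∈ Finset.range N, ∫ ξ, u i ξ ∂M.noise := by
  induction N with
  | zero => simp
  | succ N ih =>
    have hprod : ∀ (ω : ℕ → X × Ξ) y, ∏ i ∈ Finset.range (N + 1), u i (Function.update ω N y i).2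
        = (∏ i ∈ Finset.range N, u i (ω i).2) * u N y.2 := fun ω y => by
      rw [Finset.prod_range_succ, Function.update_self]
      congr 1
      refine Finset.prod_congr rfl fun i hi => ?_
      rw [Function.update_of_ne (Finset.mem_range.1 hi).ne]
    rw [P.integral_law_eq_sum φ κ s₀ (t := N) (C := 1)
      (F := fun ω => ∏ i ∈ Finset.range (N + 1), u i (ω i).2)
      (Finset.measurable_prod _ fun i _ => (hu i).comp (measurable_pi_apply i).snd)
      (fun ω => ?_) (fun ω ω' h => ?_)]
    · simp only [hprod, integral_const_mul, ← Finset.sum_mul, P.disc_sum, one_mul,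
        integral_mul_const, ih, Finset.prod_range_succ]
    · rw [Finset.abs_prod]
      exact Finset.prod_le_one (fun _ _ => abs_nonneg _) fun i _ => hu1 i _
    · exact Finset.prod_congr rfl fun i hi => by rw [h i (by simpa using hi)]

/-- Whatever the policy, the noise component of the process has the scenario law. -/
theorem map_snd_law (φ : EuclideanSpace ℝ (Fin m)) (κ : EuclideanSpace ℝ (Fin n))
    (s₀ : EuclideanSpace ℝ (Fin d)) :
    (P.law φ κ s₀).map (fun ω i => (ω i).2) = M.scenarioLaw := by
  classical
  have hm : Measurable fun (ω : ℕ → X × Ξ) i => (ω i).2 :=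
    measurable_pi_lambda _ fun i => (measurable_pi_apply i).snd
  refine Measure.eq_infinitePi _ fun s A hA => ?_
  obtain ⟨N, hN⟩ := s.exists_nat_subset_range
  have h := P.integral_law_prod_noise φ κ s₀
    (u := fun i => if i ∈ s then (A i).indicator 1 else 1)
    (fun i => by
      split_ifs
      · exact measurable_one.indicator (hA i)
      · exact measurable_one)
    (fun i ξ => by
      split_ifs
      · by_cases h : ξ ∈ A i <;> simp [h]
      · simp) N
  have hpre : MeasurableSet ((fun (ω : ℕ → X × Ξ) i => (ω i).2) ⁻¹' Set.pi s A) :=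
    hm (MeasurableSet.pi s.countable_toSet fun i _ => hA i)
  have h1 : ∀ ω : ℕ → X × Ξ, ∏ i ∈ Finset.range N,
      (if i ∈ s then (A i).indicator 1 else (1 : Ξ → ℝ)) (ω i).2
        = ((fun (ω : ℕ → X × Ξ) i => (ω i).2) ⁻¹' Set.pi s A).indicator 1 ω := fun ω => by
    rw [← Finset.prod_subset hN fun i _ hi => by simp [hi]]
    by_cases hω : ∀ i ∈ s, (ω i).2 ∈ A i
    · rw [Set.indicator_of_mem (by simpa using hω)]
      exact Finset.prod_eq_one fun i hi => by simp [hi, hω i hi]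
    · rw [Set.indicator_of_notMem (by simpa using hω)]
      push Not at hω
      obtain ⟨i, hi, hiA⟩ := hω
      exact Finset.prod_eq_zero hi (by simp [hi, hiA])
  have h2 : ∏ i ∈ Finset.range N, ∫ ξ, (if i ∈ s then (A i).indicator 1 else (1 : Ξ → ℝ)) ξ
      ∂M.noise = ∏ i ∈ s, M.noise.real (A i) := by
    rw [← Finset.prod_subset hN fun i _ hi => by simp [hi]]
    exact Finset.prod_congr rfl fun i hi => by simp [hi, integral_indicator_one (hA i)]
  simp only [h1] at h
  rw [h2, integral_indicator_one hpre] at h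
  rw [Measure.map_apply hm (MeasurableSet.pi s.countable_toSet fun i _ => hA i),
    ← ENNReal.ofReal_toReal (measure_ne_top _ _)]
  change ENNReal.ofReal ((P.law φ κ s₀).real _) = _
  rw [h, ENNReal.ofReal_prod_of_nonneg fun _ _ => measureReal_nonneg]
  exact Finset.prod_congr rfl fun i _ => ENNReal.ofReal_toReal (measure_ne_top _ _)

theorem ae_law_of_ae_scenario (φ : EuclideanSpace ℝ (Fin m)) (κ : EuclideanSpace ℝ (Fin n))
    (s₀ : EuclideanSpace ℝ (Fin d)) {q : (ℕ → X × Ξ) → Prop}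
    (h : ∀ᵐ ξ ∂M.scenarioLaw, ∀ x : ℕ → X, q (realization x ξ)) :
    ∀ᵐ ω ∂P.law φ κ s₀, q ω := by
  rw [← P.map_snd_law φ κ s₀] at h
  have hm : Measurable fun (ω : ℕ → X × Ξ) i => (ω i).2 :=
    measurable_pi_lambda _ fun i => (measurable_pi_apply i).snd
  exact (ae_of_ae_map hm.aemeasurable h).mono fun ω hω => hω fun i => (ω i).1

/-! ### Change of measure to uniformly drawn discrete actions -/

theorem nonempty_actions (P : HybridPolicy M m n) : Nonempty X := by
  by_contra h
  rw [not_nonempty_iff] at h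
  simpa using P.disc_sum 0 0

theorem card_actions_pos (P : HybridPolicy M m n) : 0 < (Fintype.card X : ℝ) := by
  have := P.nonempty_actions
  exact_mod_cast Fintype.card_pos

/-- The policy which draws the discrete action uniformly, whatever the state and the parameter. -/
def uniform : HybridPolicy M m n where
  disc _ _ _ := (Fintype.card X : ℝ)⁻¹
  cont := P.cont
  disc_nonneg _ _ _ := by positivity
  disc_sum _ _ := by simp [P.card_actions_pos.ne']
  disc_meas _ _ := measurable_const
  cont_mem := P.cont_mem
  cont_meas := P.cont_meas

/-- The reference measure: noise and uniformly drawn discrete actions, all independent. It does not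
involve the parameters, so that parameter derivatives can be taken under its integral sign. (The
parameters `0` below are placeholders: under the uniform policy, the law of the discrete actions and
the noise is the same for all parameters.) -/
def refLaw (s₀ : EuclideanSpace ℝ (Fin d)) : Measure (ℕ → X × Ξ) := P.uniform.law 0 0 s₀

instance (s₀ : EuclideanSpace ℝ (Fin d)) : IsProbabilityMeasure (P.refLaw s₀) := by
  unfold refLaw; infer_instance

/-- The density of `P.law φ κ s₀` with respect to the reference measure, on events that involve the
first `t` coordinates only. -/
def weight (φ : EuclideanSpace ℝ (Fin m)) (κ : EuclideanSpace ℝ (Fin n))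
    (s₀ : EuclideanSpace ℝ (Fin d)) (t : ℕ) (ω : ℕ → X × Ξ) : ℝ :=
  ∏ i ∈ Finset.range t, (Fintype.card X * P.prob φ κ s₀ ω i)

theorem weight_nonneg (φ : EuclideanSpace ℝ (Fin m)) (κ : EuclideanSpace ℝ (Fin n))
    (s₀ : EuclideanSpace ℝ (Fin d)) (t : ℕ) (ω : ℕ → X × Ξ) : 0 ≤ P.weight φ κ s₀ t ω :=
  Finset.prod_nonneg fun i _ => mul_nonneg (Nat.cast_nonneg _) (P.prob_nonneg φ κ s₀ ω i)

theorem weight_le (φ : EuclideanSpace ℝ (Fin m)) (κ : EuclideanSpace ℝ (Fin n))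
    (s₀ : EuclideanSpace ℝ (Fin d)) (t : ℕ) (ω : ℕ → X × Ξ) :
    P.weight φ κ s₀ t ω ≤ (Fintype.card X : ℝ) ^ t := by
  refine (Finset.prod_le_prod (g := fun _ => (Fintype.card X : ℝ))
    (fun i _ => mul_nonneg (Nat.cast_nonneg _) (P.prob_nonneg φ κ s₀ ω i))
    fun i _ => mul_le_of_le_one_right (Nat.cast_nonneg _) (P.disc_le_one _ _ _)).trans ?_
  simp

theorem measurable_weight (φ : EuclideanSpace ℝ (Fin m)) (κ : EuclideanSpace ℝ (Fin n))
    (s₀ : EuclideanSpace ℝ (Fin d)) (t : ℕ) : Measurable (P.weight φ κ s₀ t) :=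
  Finset.measurable_prod _ fun i _ => (P.measurable_prob φ κ s₀ i).const_mul _

theorem dependsOn_weight (φ : EuclideanSpace ℝ (Fin m)) (κ : EuclideanSpace ℝ (Fin n))
    (s₀ : EuclideanSpace ℝ (Fin d)) (t : ℕ) : DependsOn (P.weight φ κ s₀ t) (Set.Iio t) := by
  intro ω ω' h
  refine Finset.prod_congr rfl fun i hi => ?_
  have hi := Finset.mem_range.1 hi
  rw [P.prob_congr φ κ s₀ (fun j hj => h j (hj.trans hi)) (by rw [h i hi])]

/-- Change of measure over the first `t` time steps. At each of them the step kernel of the policy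
has density `|X| π_φ(x ∣ s_i(κ))` with respect to the uniform one. -/
theorem integral_law_eq_integral_weight (φ : EuclideanSpace ℝ (Fin m))
    (κ : EuclideanSpace ℝ (Fin n)) (s₀ : EuclideanSpace ℝ (Fin d)) {t : ℕ}
    {F : (ℕ → X × Ξ) → ℝ} (hF : Measurable F) {C : ℝ} (hC : ∀ ω, |F ω| ≤ C)
    (hdep : DependsOn F (Set.Iio t)) :
    ∫ ω, F ω ∂P.law φ κ s₀ = ∫ ω, P.weight φ κ s₀ t ω * F ω ∂P.refLaw s₀ := by
  induction t generalizing F C with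
  | zero =>
    obtain ⟨ω₀⟩ := (P.law φ κ s₀).nonempty_of_neZero
    have h : ∀ ω, F ω = F ω₀ := fun ω => hdep fun i hi => by simp at hi
    simp only [h]
    simp [weight]
  | succ t ih =>
    have hX := P.card_actions_pos
    have hC0 : 0 ≤ C := by
      obtain ⟨ω₀⟩ := (P.law φ κ s₀).nonempty_of_neZero
      exact (abs_nonneg _).trans (hC ω₀)
    have hupd : Measurable fun z : (ℕ → X × Ξ) × X × Ξ => Function.update z.1 t z.2 :=
      measurable_pi_lambda _ fun i => by
        by_cases hi : i = t
        · subst hi; simpa using measurable_snd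
        · simp only [Function.update_of_ne hi]; fun_prop
    have hint : ∀ x ω, |∫ ξ, F (Function.update ω t (x, ξ)) ∂M.noise| ≤ C := fun x ω =>
      abs_integral_le_of_abs_le fun ξ => hC _
    rw [P.integral_law_eq_sum φ κ s₀ hF hC hdep, ih (C := C)]
    · unfold refLaw
      rw [P.uniform.integral_law_eq_sum 0 0 s₀ (t := t)
        (F := fun ω => P.weight φ κ s₀ (t + 1) ω * F ω)
        (C := (Fintype.card X : ℝ) ^ (t + 1) * C)
        ((P.measurable_weight φ κ s₀ _).mul hF) (fun ω => ?_) (fun ω ω' h => ?_)]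
      · refine integral_congr_ae (.of_forall fun ω => ?_)
        simp only [Finset.mul_sum]
        refine Finset.sum_congr rfl fun x _ => ?_
        have hw : ∀ ξ, P.weight φ κ s₀ (t + 1) (Function.update ω t (x, ξ))
            = P.weight φ κ s₀ t ω * (Fintype.card X * P.disc φ (P.state κ s₀ ω t) x) :=
          fun ξ => by
            rw [weight, Finset.prod_range_succ]
            congr 1
            · exact P.dependsOn_weight φ κ s₀ t fun i hi =>
                Function.update_of_ne (Set.mem_Iio.1 hi).ne _ _
            · simp only [prob, P.state_update, Function.update_self]
        simp only [hw, integral_const_mul, uniform]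
        field_simp
      · rw [abs_mul, abs_of_nonneg (P.weight_nonneg φ κ s₀ _ ω)]
        exact mul_le_mul (P.weight_le φ κ s₀ _ ω) (hC ω) (abs_nonneg _) (by positivity)
      · simp only [hdep h, P.dependsOn_weight φ κ s₀ _ h]
    · refine Finset.measurable_sum _ fun x _ =>
        ((P.disc_meas φ x).comp (P.measurable_state κ s₀ t)).mul ?_
      have : Measurable fun z : (ℕ → X × Ξ) × Ξ => F (Function.update z.1 t (x, z.2)) :=
        hF.comp (hupd.comp (measurable_fst.prodMk (measurable_const.prodMk measurable_snd)))
      exact this.stronglyMeasurable.integral_prod_right.measurable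
    · exact fun ω => P.abs_sum_disc_mul_le φ _ fun x => hint x ω
    · intro ω ω' h
      have hu : ∀ y, F (Function.update ω t y) = F (Function.update ω' t y) := fun y =>
        hdep fun i hi => by
          rcases eq_or_ne i t with rfl | hne
          · simp
          · simp only [Function.update_of_ne hne]
            exact h i (lt_of_le_of_ne (Nat.lt_succ_iff.1 hi) hne)
      simp only [hu, P.state_congr κ s₀ h]

theorem integral_weight (φ : EuclideanSpace ℝ (Fin m)) (κ : EuclideanSpace ℝ (Fin n))
    (s₀ : EuclideanSpace ℝ (Fin d)) (t : ℕ) : ∫ ω, P.weight φ κ s₀ t ω ∂P.refLaw s₀ = 1 := by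
  have h := P.integral_law_eq_integral_weight φ κ s₀ (t := t) (F := fun _ => 1)
    measurable_const (C := 1) (by simp) (fun _ _ _ => rfl)
  simpa using h.symm

/-! ### The action-value function as a discounted series -/

/-- The expected cost `k` steps after the discrete action `x` has been taken in the state `s`, with
the continuous action prescribed by the policy, which is also followed afterwards. -/
def delayedCost (φ : EuclideanSpace ℝ (Fin m)) (κ : EuclideanSpace ℝ (Fin n)) :
    ℕ → EuclideanSpace ℝ (Fin d) → X → ℝ
  | 0, s, x => ∫ ξ, M.c s x (P.cont κ s x) ξ ∂M.noise
  | k + 1, s, x => ∫ ξ, ∑ x', P.disc φ (M.f s x (P.cont κ s x) ξ) x' *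
      delayedCost φ κ k (M.f s x (P.cont κ s x) ξ) x' ∂M.noise

theorem measurable_transition (κ : EuclideanSpace ℝ (Fin n)) (x : X) :
    Measurable fun z : EuclideanSpace ℝ (Fin d) × Ξ => M.f z.1 x (P.cont κ z.1 x) z.2 :=
  (M.f_meas x).comp ((measurable_fst.prodMk ((P.cont_meas κ x).comp measurable_fst)).prodMk
    measurable_snd)

theorem measurable_delayedCost (φ : EuclideanSpace ℝ (Fin m)) (κ : EuclideanSpace ℝ (Fin n))
    (k : ℕ) (x : X) : Measurable fun s => P.delayedCost φ κ k s x := by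
  induction k generalizing x with
  | zero =>
    have : Measurable fun z : EuclideanSpace ℝ (Fin d) × Ξ => M.c z.1 x (P.cont κ z.1 x) z.2 :=
      (M.c_meas x).comp ((measurable_fst.prodMk ((P.cont_meas κ x).comp measurable_fst)).prodMk
        measurable_snd)
    exact this.stronglyMeasurable.integral_prod_right.measurable
  | succ k ih =>
    have : Measurable fun z : EuclideanSpace ℝ (Fin d) × Ξ =>
        ∑ x', P.disc φ (M.f z.1 x (P.cont κ z.1 x) z.2) x' *
          P.delayedCost φ κ k (M.f z.1 x (P.cont κ z.1 x) z.2) x' :=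
      Finset.measurable_sum _ fun x' _ => ((P.disc_meas φ x').mul (ih x')).comp
        (P.measurable_transition κ x)
    exact this.stronglyMeasurable.integral_prod_right.measurable

theorem abs_delayedCost_le {C : ℝ}
    (hC : ∀ s ∈ M.states, ∀ x, ∀ b ∈ M.feasible x, ∀ ξ, |M.c s x b ξ| ≤ C)
    (φ : EuclideanSpace ℝ (Fin m)) (κ : EuclideanSpace ℝ (Fin n)) (k : ℕ)
    {s : EuclideanSpace ℝ (Fin d)} (hs : s ∈ M.states) (x : X) :
    |P.delayedCost φ κ k s x| ≤ C := by
  induction k generalizing s x with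
  | zero =>
    exact abs_integral_le_of_abs_le fun ξ => hC s hs x _ (P.cont_mem κ s hs x) ξ
  | succ k ih =>
    exact abs_integral_le_of_abs_le fun ξ => P.abs_sum_disc_mul_le φ _ fun x' =>
      ih (M.f_mem s hs x _ (P.cont_mem κ s hs x) ξ) x'

theorem measurable_delayedCost_state (φ : EuclideanSpace ℝ (Fin m))
    (κ : EuclideanSpace ℝ (Fin n)) (s₀ : EuclideanSpace ℝ (Fin d)) (k t : ℕ) :
    Measurable fun ω : ℕ → X × Ξ => P.delayedCost φ κ k (P.state κ s₀ ω t) (ω t).1 := by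
  have h : Measurable fun z : X × EuclideanSpace ℝ (Fin d) => P.delayedCost φ κ k z.2 z.1 :=
    measurable_from_prod_countable_right fun x => P.measurable_delayedCost φ κ k x
  exact h.comp (((measurable_pi_apply t).fst).prodMk (P.measurable_state κ s₀ t))

/-- Reward-to-go: a factor determined by `ω_{<t}` and `x_t` sees the cost at time `t + k` only
through its conditional expectation given the state and the action at time `t`. -/
theorem integral_mul_cost_eq {C : ℝ}
    (hC : ∀ s ∈ M.states, ∀ x, ∀ b ∈ M.feasible x, ∀ ξ, |M.c s x b ξ| ≤ C)
    {s₀ : EuclideanSpace ℝ (Fin d)} (hs₀ : s₀ ∈ M.states)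
    (φ : EuclideanSpace ℝ (Fin m)) (κ : EuclideanSpace ℝ (Fin n)) (k : ℕ) {t : ℕ}
    {G : (ℕ → X × Ξ) → ℝ} (hG : Measurable G) {B : ℝ} (hB : ∀ ω, |G ω| ≤ B)
    (hdep : ∀ ω ω', (∀ i < t, ω i = ω' i) → (ω t).1 = (ω' t).1 → G ω = G ω') :
    ∫ ω, G ω * P.cost κ s₀ ω (t + k) ∂P.law φ κ s₀
      = ∫ ω, G ω * P.delayedCost φ κ k (P.state κ s₀ ω t) (ω t).1 ∂P.law φ κ s₀ := by
  have hbound : ∀ {a b : ℝ}, |a| ≤ B → |b| ≤ C → |a * b| ≤ B * C := fun ha hb => by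
    rw [abs_mul]
    exact mul_le_mul ha hb (abs_nonneg _) ((abs_nonneg _).trans ha)
  induction k generalizing t G with
  | zero =>
    rw [Nat.add_zero,
      P.integral_law_eq_sum φ κ s₀ (t := t) (F := fun ω => G ω * P.cost κ s₀ ω t)
        (hG.mul (P.measurable_cost κ s₀ t))
        (fun ω => hbound (hB ω) (P.abs_cost_le hC hs₀ κ ω t))
        (fun ω ω' h => by
          simp only [P.cost_congr κ s₀ h, hdep ω ω' (fun i hi => h i (hi.trans t.lt_succ_self))
            (by rw [h t t.lt_succ_self])]),
      P.integral_law_eq_sum φ κ s₀ (t := t)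
        (F := fun ω => G ω * P.delayedCost φ κ 0 (P.state κ s₀ ω t) (ω t).1)
        (hG.mul (P.measurable_delayedCost_state φ κ s₀ 0 t))
        (fun ω => hbound (hB ω) (P.abs_delayedCost_le hC φ κ 0 (P.state_mem hs₀ κ ω t) _))
        (fun ω ω' h => by
          simp only [P.state_congr κ s₀ fun i hi => h i (hi.trans t.lt_succ_self),
            h t t.lt_succ_self, hdep ω ω' (fun i hi => h i (hi.trans t.lt_succ_self))
            (by rw [h t t.lt_succ_self])])]
    refine integral_congr_ae (.of_forall fun ω => Finset.sum_congr rfl fun x _ => ?_)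
    have hGx : ∀ ξ, G (Function.update ω t (x, ξ)) = G (Function.update ω t (x, (ω t).2)) :=
      fun ξ => hdep _ _ (fun i hi => by simp [Function.update_of_ne hi.ne]) (by simp)
    simp only [hGx, cost, action, P.state_update, Function.update_self, integral_const_mul,
      delayedCost]
    simp
  | succ k ih =>
    have hV : Measurable fun s => ∑ x, P.disc φ s x * P.delayedCost φ κ k s x :=
      Finset.measurable_sum _ fun x _ => (P.disc_meas φ x).mul (P.measurable_delayedCost φ κ k x)
    have hVC : ∀ s ∈ M.states, |∑ x, P.disc φ s x * P.delayedCost φ κ k s x| ≤ C := fun s hs =>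
      P.abs_sum_disc_mul_le φ s fun x => P.abs_delayedCost_le hC φ κ k hs x
    have hG' : DependsOn G (Set.Iio (t + 1)) := fun ω ω' h =>
      hdep ω ω' (fun i hi => h i (hi.trans t.lt_succ_self)) (by rw [h t t.lt_succ_self])
    rw [show t + (k + 1) = t + 1 + k by ring, ih hG hB fun ω ω' h _ => hG' h,
      P.integral_law_eq_sum φ κ s₀ (t := t + 1)
        (F := fun ω => G ω * P.delayedCost φ κ k (P.state κ s₀ ω (t + 1)) (ω (t + 1)).1)
        (hG.mul (P.measurable_delayedCost_state φ κ s₀ k (t + 1)))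
        (fun ω => hbound (hB ω) (P.abs_delayedCost_le hC φ κ k (P.state_mem hs₀ κ ω _) _))
        (fun ω ω' h => by
          simp only [P.state_congr κ s₀ fun i hi => h i (hi.trans (t + 1).lt_succ_self),
            h (t + 1) (t + 1).lt_succ_self,
            hG' fun i hi => h i (lt_trans (Set.mem_Iio.1 hi) (t + 1).lt_succ_self)])]
    have hGu : ∀ ω y, G (Function.update ω (t + 1) y) = G ω := fun ω y =>
      hG' fun i hi => Function.update_of_ne (Set.mem_Iio.1 hi).ne _ _
    have hstep : ∀ ω : ℕ → X × Ξ, ∑ x, P.disc φ (P.state κ s₀ ω (t + 1)) x *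
        ∫ ξ, G (Function.update ω (t + 1) (x, ξ)) *
          P.delayedCost φ κ k (P.state κ s₀ (Function.update ω (t + 1) (x, ξ)) (t + 1))
            (Function.update ω (t + 1) (x, ξ) (t + 1)).1 ∂M.noise
        = G ω * ∑ x, P.disc φ (P.state κ s₀ ω (t + 1)) x *
            P.delayedCost φ κ k (P.state κ s₀ ω (t + 1)) x := fun ω => by
      rw [Finset.mul_sum]
      refine Finset.sum_congr rfl fun x _ => ?_
      simp only [hGu, P.state_update, Function.update_self]
      simp
      ring
    simp only [hstep]
    rw [P.integral_law_eq_sum φ κ s₀ (t := t)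
        (F := fun ω => G ω * ∑ x, P.disc φ (P.state κ s₀ ω (t + 1)) x *
            P.delayedCost φ κ k (P.state κ s₀ ω (t + 1)) x)
        (hG.mul (hV.comp (P.measurable_state κ s₀ (t + 1))))
        (fun ω => hbound (hB ω) (hVC _ (P.state_mem hs₀ κ ω _)))
        (fun ω ω' h => by simp only [P.state_congr κ s₀ h, hG' h]),
      P.integral_law_eq_sum φ κ s₀ (t := t)
        (F := fun ω => G ω * P.delayedCost φ κ (k + 1) (P.state κ s₀ ω t) (ω t).1)
        (hG.mul (P.measurable_delayedCost_state φ κ s₀ (k + 1) t))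
        (fun ω => hbound (hB ω) (P.abs_delayedCost_le hC φ κ _ (P.state_mem hs₀ κ ω t) _))
        (fun ω ω' h => by
          simp only [P.state_congr κ s₀ fun i hi => h i (hi.trans t.lt_succ_self),
            h t t.lt_succ_self, hG' h])]
    refine integral_congr_ae (.of_forall fun ω => Finset.sum_congr rfl fun x _ => ?_)
    have hGx : ∀ ξ, G (Function.update ω t (x, ξ)) = G (Function.update ω t (x, (ω t).2)) :=
      fun ξ => hdep _ _ (fun i hi => by simp [Function.update_of_ne hi.ne]) (by simp)
    simp only [hGx, state, P.state_update, Function.update_self, integral_const_mul, delayedCost]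
    simp

theorem integral_cost_eq {C : ℝ}
    (hC : ∀ s ∈ M.states, ∀ x, ∀ b ∈ M.feasible x, ∀ ξ, |M.c s x b ξ| ≤ C)
    {s₀ : EuclideanSpace ℝ (Fin d)} (hs₀ : s₀ ∈ M.states)
    (φ : EuclideanSpace ℝ (Fin m)) (κ : EuclideanSpace ℝ (Fin n)) (k : ℕ) :
    ∫ ω, P.cost κ s₀ ω k ∂P.law φ κ s₀ = ∑ x, P.disc φ s₀ x * P.delayedCost φ κ k s₀ x := by
  have h := P.integral_mul_cost_eq hC hs₀ φ κ k (t := 0) (G := fun _ => 1) measurable_const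
    (B := 1) (by simp) (fun _ _ _ _ => rfl)
  simp only [one_mul, zero_add] at h
  rw [h, P.integral_law_eq_sum φ κ s₀ (t := 0)
    (F := fun ω => P.delayedCost φ κ k (P.state κ s₀ ω 0) (ω 0).1)
    (P.measurable_delayedCost_state φ κ s₀ k 0)
    (fun ω => P.abs_delayedCost_le hC φ κ k (P.state_mem hs₀ κ ω 0) _)
    (fun ω ω' h => by simp only [state, h 0 (Set.mem_Iio.2 Nat.one_pos)])]
  simp [state]

theorem summable_discount_mul (C : ℝ) : Summable fun t : ℕ => M.γ ^ t * C :=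
  (summable_geometric_of_lt_one M.γ_pos.le M.γ_lt_one).mul_right C

theorem abs_discount_mul_le (t : ℕ) {a C : ℝ} (ha : |a| ≤ C) :
    |M.γ ^ t * a| ≤ M.γ ^ t * C := by
  have h := pow_nonneg M.γ_pos.le t
  rw [abs_mul, abs_of_nonneg h]
  exact mul_le_mul_of_nonneg_left ha h

theorem seriesIntegrable_cost {C : ℝ}
    (hC : ∀ s ∈ M.states, ∀ x, ∀ b ∈ M.feasible x, ∀ ξ, |M.c s x b ξ| ≤ C)
    {s₀ : EuclideanSpace ℝ (Fin d)} (hs₀ : s₀ ∈ M.states)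
    (φ : EuclideanSpace ℝ (Fin m)) (κ : EuclideanSpace ℝ (Fin n)) :
    SeriesIntegrable (P.law φ κ s₀) (fun ω t => M.γ ^ t * P.cost κ s₀ ω t) ∧
      HasSum (fun t => M.γ ^ t * ∫ ω, P.cost κ s₀ ω t ∂P.law φ κ s₀) (P.J s₀ φ κ) := by
  have h := SeriesIntegrable.of_norm_le (μ := P.law φ κ s₀)
    (F := fun ω t => M.γ ^ t * P.cost κ s₀ ω t)
    (fun t => ((P.measurable_cost κ s₀ t).const_mul _).aestronglyMeasurable)
    (.of_forall fun ω t => abs_discount_mul_le t (P.abs_cost_le hC hs₀ κ ω t))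
    (summable_discount_mul (M := M) C)
  simp only [integral_const_mul] at h
  exact h

/-- Along the policy, the action-value function is the discounted sum of the expected delayed costs.
Off `M.states` costs may be unbounded, and the integrals defining `Q` meaningless. -/
theorem hasSum_Q {C : ℝ}
    (hC : ∀ s ∈ M.states, ∀ x, ∀ b ∈ M.feasible x, ∀ ξ, |M.c s x b ξ| ≤ C)
    (φ : EuclideanSpace ℝ (Fin m)) (κ : EuclideanSpace ℝ (Fin n))
    {s : EuclideanSpace ℝ (Fin d)} (hs : s ∈ M.states) (x : X) :
    HasSum (fun k => M.γ ^ k * P.delayedCost φ κ k s x) (P.Q φ κ s x (P.cont κ s x)) := by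
  set b := P.cont κ s x with hb
  have hbm : b ∈ M.feasible x := P.cont_mem κ s hs x
  have hfm : ∀ ξ, M.f s x b ξ ∈ M.states := fun ξ => M.f_mem s hs x b hbm ξ
  let V : ℕ → EuclideanSpace ℝ (Fin d) → ℝ := fun t s' =>
    ∑ x', P.disc φ s' x' * P.delayedCost φ κ t s' x'
  have hVm : ∀ t, Measurable (V t) := fun t => Finset.measurable_sum _ fun x' _ =>
    (P.disc_meas φ x').mul (P.measurable_delayedCost φ κ t x')
  have hVC : ∀ t ξ, |V t (M.f s x b ξ)| ≤ C := fun t ξ =>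
    P.abs_sum_disc_mul_le φ _ fun x' => P.abs_delayedCost_le hC φ κ t (hfm ξ) x'
  have hfmeas : Measurable fun ξ => M.f s x b ξ :=
    (P.measurable_transition κ x).comp (measurable_const.prodMk measurable_id)
  have hcmeas : Measurable fun ξ => M.c s x b ξ :=
    (M.c_meas x).comp ((measurable_const (a := (s, b))).prodMk measurable_id)
  have hinner : ∀ ξ, ∫ ω, (M.c s x b ξ + ∑' t, M.γ ^ (t + 1) * P.cost κ (M.f s x b ξ) ω t)
      ∂(P.law φ κ (M.f s x b ξ)) = M.c s x b ξ + M.γ * ∑' t, M.γ ^ t * V t (M.f s x b ξ) := by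
    intro ξ
    obtain ⟨⟨-, h1⟩, h2⟩ := P.seriesIntegrable_cost hC (hfm ξ) φ κ
    simp only [pow_succ', mul_assoc, tsum_mul_left]
    rw [integral_add (integrable_const _) (h1.const_mul _), integral_const_mul]
    simp only [integral_const, probReal_univ, one_smul, V]
    simp only [← P.integral_cost_eq hC (hfm ξ) φ κ]
    rw [h2.tsum_eq]
    rfl
  obtain ⟨⟨-, h1⟩, h2⟩ := SeriesIntegrable.of_norm_le (μ := M.noise)
    (F := fun ξ t => M.γ ^ t * V t (M.f s x b ξ))
    (fun t => (((hVm t).comp hfmeas).const_mul _).aestronglyMeasurable)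
    (.of_forall fun ξ t => abs_discount_mul_le t (hVC t ξ)) (summable_discount_mul (M := M) C)
  have hc : Integrable (fun ξ => M.c s x b ξ) M.noise :=
    Integrable.of_bound hcmeas.aestronglyMeasurable C (.of_forall fun ξ => hC s hs x b hbm ξ)
  have hQ : P.Q φ κ s x b = M.γ ^ 0 * P.delayedCost φ κ 0 s x
      + M.γ * ∫ ξ, ∑' t, M.γ ^ t * V t (M.f s x b ξ) ∂M.noise := by
    rw [Q]
    simp only [hinner]
    rw [integral_add hc (h1.const_mul _), integral_const_mul, delayedCost, pow_zero, one_mul]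
  rw [hQ]
  refine HasSum.zero_add (f := fun k => M.γ ^ k * P.delayedCost φ κ k s x) ?_
  refine (h2.mul_left M.γ).congr_fun fun t => ?_
  rw [integral_const_mul, delayedCost, pow_succ']
  ring

theorem abs_Q_le {C : ℝ}
    (hC : ∀ s ∈ M.states, ∀ x, ∀ b ∈ M.feasible x, ∀ ξ, |M.c s x b ξ| ≤ C)
    (φ : EuclideanSpace ℝ (Fin m)) (κ : EuclideanSpace ℝ (Fin n))
    {s : EuclideanSpace ℝ (Fin d)} (hs : s ∈ M.states) (x : X) :
    |P.Q φ κ s x (P.cont κ s x)| ≤ ∑' t, M.γ ^ t * C := by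
  rw [← (P.hasSum_Q hC φ κ hs x).tsum_eq]
  exact tsum_of_norm_bounded (f := fun k => M.γ ^ k * P.delayedCost φ κ k s x)
    (summable_discount_mul (M := M) C).hasSum fun t =>
      abs_discount_mul_le t (P.abs_delayedCost_le hC φ κ t hs x)

theorem measurable_Q_state {C : ℝ}
    (hC : ∀ s ∈ M.states, ∀ x, ∀ b ∈ M.feasible x, ∀ ξ, |M.c s x b ξ| ≤ C)
    {s₀ : EuclideanSpace ℝ (Fin d)} (hs₀ : s₀ ∈ M.states)
    (φ : EuclideanSpace ℝ (Fin m)) (κ : EuclideanSpace ℝ (Fin n)) (t : ℕ) :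
    Measurable fun ω : ℕ → X × Ξ =>
      P.Q φ κ (P.state κ s₀ ω t) (ω t).1 (P.action κ s₀ ω t) := by
  refine measurable_of_tendsto_metrizable
    (f := fun N ω => ∑ k ∈ Finset.range N,
      M.γ ^ k * P.delayedCost φ κ k (P.state κ s₀ ω t) (ω t).1)
    (fun N => Finset.measurable_sum _ fun k _ =>
      (P.measurable_delayedCost_state φ κ s₀ k t).const_mul _) ?_
  exact tendsto_pi_nhds.2 fun ω =>
    (P.hasSum_Q hC φ κ (P.state_mem hs₀ κ ω t) (ω t).1).tendsto_sum_nat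

/-- Reward-to-go, summed over the delay: a factor determined by `ω_{<t}` and `x_t` sees the
discounted costs from time `t` on only through the action-value function. -/
theorem hasSum_integral_mul_cost {C : ℝ}
    (hC : ∀ s ∈ M.states, ∀ x, ∀ b ∈ M.feasible x, ∀ ξ, |M.c s x b ξ| ≤ C)
    {s₀ : EuclideanSpace ℝ (Fin d)} (hs₀ : s₀ ∈ M.states)
    (φ : EuclideanSpace ℝ (Fin m)) (κ : EuclideanSpace ℝ (Fin n)) {t : ℕ}
    {G : (ℕ → X × Ξ) → ℝ} (hG : Measurable G) {B : ℝ} (hB : ∀ ω, |G ω| ≤ B)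
    (hdep : ∀ ω ω', (∀ i < t, ω i = ω' i) → (ω t).1 = (ω' t).1 → G ω = G ω') :
    HasSum (fun k => M.γ ^ k * ∫ ω, G ω * P.cost κ s₀ ω (t + k) ∂P.law φ κ s₀)
      (∫ ω, G ω * P.Q φ κ (P.state κ s₀ ω t) (ω t).1 (P.action κ s₀ ω t) ∂P.law φ κ s₀) := by
  have h := (SeriesIntegrable.of_norm_le (μ := P.law φ κ s₀)
    (F := fun ω k => M.γ ^ k *
      (G ω * P.delayedCost φ κ k (P.state κ s₀ ω t) (ω t).1)) (b := fun k => M.γ ^ k * (B * C))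
    (fun k => ((hG.mul (P.measurable_delayedCost_state φ κ s₀ k t)).const_mul
      _).aestronglyMeasurable)
    (.of_forall fun ω k => abs_discount_mul_le k (by
      rw [abs_mul]
      exact mul_le_mul (hB ω) (P.abs_delayedCost_le hC φ κ k (P.state_mem hs₀ κ ω t) _)
        (abs_nonneg _) ((abs_nonneg _).trans (hB ω))))
    (summable_discount_mul (M := M) _)).2
  have hlim : ∫ ω, ∑' k, M.γ ^ k * (G ω * P.delayedCost φ κ k (P.state κ s₀ ω t) (ω t).1)
      ∂P.law φ κ s₀
      = ∫ ω, G ω * P.Q φ κ (P.state κ s₀ ω t) (ω t).1 (P.action κ s₀ ω t) ∂P.law φ κ s₀ := by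
    refine integral_congr_ae (.of_forall fun ω => ?_)
    have hQ := (P.hasSum_Q hC φ κ (P.state_mem hs₀ κ ω t) (ω t).1).mul_left (G ω)
    simp only [mul_left_comm (G ω)] at hQ
    exact hQ.tsum_eq
  rw [hlim] at h
  refine h.congr_fun fun k => ?_
  rw [integral_const_mul, P.integral_mul_cost_eq hC hs₀ φ κ k hG hB hdep]

end HybridPolicy

/-! ### Differentiation: general facts -/

/-- A derivative along `v` at a single point, where it exists and is bounded by `B`, is the value of
an everywhere bounded measurable function which depends on `ω` only through the differentiated
functions. -/
theorem exists_measurable_eq_fderiv {Ω E : Type*} [MeasurableSpace Ω] [NormedAddCommGroup E]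
    [NormedSpace ℝ E] {F : E → Ω → ℝ} (hF : ∀ e, Measurable (F e)) (e₀ v : E) {B : ℝ}
    (hB : 0 ≤ B) :
    ∃ G : Ω → ℝ, Measurable G ∧ (∀ ω, |G ω| ≤ B) ∧
      (∀ ω ω', (∀ e, F e ω = F e ω') → G ω = G ω') ∧
      ∀ ω, DifferentiableAt ℝ (fun e => F e ω) e₀ → |fderiv ℝ (fun e => F e ω) e₀ v| ≤ B →
        G ω = fderiv ℝ (fun e => F e ω) e₀ v := by
  let q : ℕ → Ω → ℝ := fun k ω => (k : ℝ) * (F (e₀ + (k : ℝ)⁻¹ • v) ω - F e₀ ω)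
  have hq : ∀ k, Measurable (q k) := fun k => ((hF _).sub (hF _)).const_mul _
  -- The limit superior is a junk value where the quotients are unbounded; clamping it to `[-B, B]`
  -- makes the bound hold there as well, and changes nothing where the derivative is as assumed.
  refine ⟨fun ω => max (-B) (min (Filter.limsup (fun k => q k ω) Filter.atTop) B), ?_, ?_, ?_, ?_⟩
  · exact measurable_const.max ((Measurable.limsup hq).min measurable_const)
  · exact fun ω => abs_le.2 ⟨le_max_left _ _, max_le (by linarith) (min_le_right _ _)⟩
  · intro ω ω' h
    simp only [q, h]
  · intro ω hd hb
    have hlim : Filter.Tendsto (fun k => q k ω) Filter.atTop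
        (nhds (fderiv ℝ (fun e => F e ω) e₀ v)) :=
      hd.hasFDerivAt.lim v (by simpa using tendsto_natCast_atTop_atTop (R := ℝ))
    simp only [hlim.limsup_eq]
    rw [min_eq_left (abs_le.1 hb).2, max_eq_right (abs_le.1 hb).1]

theorem aestronglyMeasurable_of_apply {Ω E : Type*} [MeasurableSpace Ω] [NormedAddCommGroup E]
    [NormedSpace ℝ E] [FiniteDimensional ℝ E] {μ : Measure Ω} {T : Ω → E →L[ℝ] ℝ}
    (hT : ∀ v, AEStronglyMeasurable (fun ω => T ω v) μ) : AEStronglyMeasurable T μ := by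
  let b := Module.finBasis ℝ E
  have h : T = fun ω => ∑ i, T ω (b i) • LinearMap.toContinuousLinearMap (b.coord i) := by
    ext ω v
    calc T ω v = T ω (∑ i, b.repr v i • b i) := by rw [b.sum_repr]
      _ = _ := by
        simp only [map_sum, map_smul, smul_eq_mul, _root_.sum_apply,
          _root_.smul_apply, LinearMap.coe_toContinuousLinearMap',
          Module.Basis.coord_apply]
        exact Finset.sum_congr rfl fun i _ => mul_comm _ _
  rw [h]
  exact Finset.aestronglyMeasurable_fun_sum _ fun i _ => (hT (b i)).smul_const _

theorem abs_exp_sub_exp_le (a b : ℝ) :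
    |Real.exp a - Real.exp b| ≤ (Real.exp a + Real.exp b) * |a - b| := by
  wlog h : b ≤ a generalizing a b
  · rw [abs_sub_comm, abs_sub_comm a, add_comm]
    exact this b a (le_of_not_ge h)
  have h1 : Real.exp a * (1 - Real.exp (b - a)) = Real.exp a - Real.exp b := by
    rw [mul_sub, ← Real.exp_add]; ring_nf
  rw [abs_of_nonneg (sub_nonneg.2 (Real.exp_le_exp.2 h)), abs_of_nonneg (sub_nonneg.2 h), ← h1]
  have h2 := Real.add_one_le_exp (b - a)
  exact mul_le_mul (le_add_of_nonneg_right (Real.exp_pos b).le) (by linarith)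
    (sub_nonneg.2 (Real.exp_le_one_iff.2 (by linarith))) (by positivity)

/-- Termwise differentiation at a single point: dominated convergence for the counting measure. -/
theorem hasFDerivAt_tsum_of_lipschitzOn {E : Type*} [NormedAddCommGroup E] [NormedSpace ℝ E]
    {g : ℕ → E → ℝ} {g' : ℕ → E →L[ℝ] ℝ} {e₀ : E} {s : Set E} {b : ℕ → ℝ}
    (hs : s ∈ nhds e₀) (hg : ∀ t, HasFDerivAt (g t) (g' t) e₀)
    (hlip : ∀ t, LipschitzOnWith (Real.nnabs (b t)) (g t) s) (hb : Summable b)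
    (hsum : ∀ e, Summable fun t => g t e) :
    Summable g' ∧ HasFDerivAt (fun e => ∑' t, g t e) (∑' t, g' t) e₀ := by
  have hint : ∀ e, Integrable (fun t => g t e) Measure.count := fun e =>
    integrable_count_iff.2 (hsum e).norm
  obtain ⟨h1, h2⟩ := hasFDerivAt_integral_of_dominated_loc_of_lip (μ := Measure.count)
    (F := fun e t => g t e) (F' := g') (bound := b) hs
    (.of_forall fun e => (hint e).aestronglyMeasurable) (hint e₀)
    StronglyMeasurable.of_discrete.aestronglyMeasurable (.of_forall hlip)
    (integrable_count_iff.2 hb.norm) (.of_forall hg)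
  refine ⟨(integrable_count_iff.1 h1).of_norm, ?_⟩
  have e1 : ∀ e, ∫ t, g t e ∂Measure.count = ∑' t, g t e := fun e => by
    rw [integral_countable (hint e)]
    simp
  have e2 : ∫ t, g' t ∂Measure.count = ∑' t, g' t := by
    rw [integral_countable h1]
    simp
  simpa only [e1, e2] using h2

theorem hasSum_sum_range_of_hasSum_prod {a : ℕ → ℕ → ℝ} {S : ℝ}
    (ha : HasSum (fun z : ℕ × ℕ => a z.1 z.2) S) :
    HasSum (fun n => ∑ i ∈ Finset.range (n + 1), a i (n - i)) S := by
  have h := ((Equiv.hasSum_iff Finset.HasAntidiagonal.sigmaAntidiagonalEquivProd).2 ha).sigma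
    (g := fun n => ∑ i ∈ Finset.range (n + 1), a i (n - i)) fun n => ?_
  · exact h
  · rw [← Finset.Nat.sum_antidiagonal_eq_sum_range_succ (fun i k => a i k)]
    have := hasSum_fintype fun z : Finset.HasAntidiagonal.antidiagonal n => a z.1.1 z.1.2
    rwa [Finset.sum_coe_sort (Finset.HasAntidiagonal.antidiagonal n)
      fun z : ℕ × ℕ => a z.1 z.2] at this

namespace HybridPolicy

variable {X Ξ : Type*} [Fintype X] [MeasurableSpace X] [DiscreteMeasurableSpace X]
  [MeasurableSpace Ξ] {d p : ℕ} {M : HybridMDP X Ξ d p} {m n : ℕ} (P : HybridPolicy M m n)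

/-! ### Smooth families of parameters -/

/-- A realization `ω` is regular for the family of parameters `e ↦ (Φ e, K e)`, on the ball of
radius `r` around `e₀`: all probabilities are positive, log-probabilities and costs are
`L`-Lipschitz on the ball, and both are differentiable at its center. The families of interest are
`φ ↦ (φ, κ)`, `κ ↦ (φ, κ)` and the identity. -/
structure RegularPath {E : Type*} [NormedAddCommGroup E] [NormedSpace ℝ E]
    (s₀ : EuclideanSpace ℝ (Fin d)) (Φ : E → EuclideanSpace ℝ (Fin m))
    (K : E → EuclideanSpace ℝ (Fin n)) (e₀ : E) (r : ℝ) (L : NNReal) (ω : ℕ → X × Ξ) : Prop where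
  prob_pos : ∀ t, ∀ e ∈ Metric.ball e₀ r, 0 < P.prob (Φ e) (K e) s₀ ω t
  logProb_lip : ∀ t,
    LipschitzOnWith L (fun e => P.logProb (Φ e) (K e) s₀ ω t) (Metric.ball e₀ r)
  cost_lip : ∀ t, LipschitzOnWith L (fun e => P.cost (K e) s₀ ω t) (Metric.ball e₀ r)
  logProb_diff : ∀ t, DifferentiableAt ℝ (fun e => P.logProb (Φ e) (K e) s₀ ω t) e₀
  cost_diff : ∀ t, DifferentiableAt ℝ (fun e => P.cost (K e) s₀ ω t) e₀

namespace RegularPath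

variable {P} {E : Type*} [NormedAddCommGroup E] [NormedSpace ℝ E] {s₀ : EuclideanSpace ℝ (Fin d)}
  {Φ : E → EuclideanSpace ℝ (Fin m)} {K : E → EuclideanSpace ℝ (Fin n)} {e₀ : E} {r : ℝ}
  {L : NNReal} {ω : ℕ → X × Ξ}

theorem norm_fderiv_logProb_le (h : P.RegularPath s₀ Φ K e₀ r L ω) (hr : 0 < r) (t : ℕ) :
    ‖fderiv ℝ (fun e => P.logProb (Φ e) (K e) s₀ ω t) e₀‖ ≤ L :=
  norm_fderiv_le_of_lipschitzOn ℝ (Metric.ball_mem_nhds e₀ hr) (h.logProb_lip t)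

theorem norm_fderiv_cost_le (h : P.RegularPath s₀ Φ K e₀ r L ω) (hr : 0 < r) (t : ℕ) :
    ‖fderiv ℝ (fun e => P.cost (K e) s₀ ω t) e₀‖ ≤ L :=
  norm_fderiv_le_of_lipschitzOn ℝ (Metric.ball_mem_nhds e₀ hr) (h.cost_lip t)

theorem weight_eq_exp (h : P.RegularPath s₀ Φ K e₀ r L ω) (t : ℕ) {e : E}
    (he : e ∈ Metric.ball e₀ r) :
    P.weight (Φ e) (K e) s₀ t ω = (Fintype.card X : ℝ) ^ t *
      Real.exp (∑ i ∈ Finset.range t, P.logProb (Φ e) (K e) s₀ ω i) := by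
  rw [weight, Finset.prod_mul_distrib, Real.exp_sum]
  congr 1
  · simp
  · exact Finset.prod_congr rfl fun i _ => (Real.exp_log (h.prob_pos i e he)).symm

theorem abs_weight_sub_le (h : P.RegularPath s₀ Φ K e₀ r L ω) (t : ℕ) {e e' : E}
    (he : e ∈ Metric.ball e₀ r) (he' : e' ∈ Metric.ball e₀ r) :
    |P.weight (Φ e) (K e) s₀ t ω - P.weight (Φ e') (K e') s₀ t ω|
      ≤ (P.weight (Φ e) (K e) s₀ t ω + P.weight (Φ e') (K e') s₀ t ω) * (t * L * ‖e - e'‖) := by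
  have hS : |∑ i ∈ Finset.range t, P.logProb (Φ e) (K e) s₀ ω i
      - ∑ i ∈ Finset.range t, P.logProb (Φ e') (K e') s₀ ω i| ≤ t * L * ‖e - e'‖ := by
    rw [← Finset.sum_sub_distrib]
    refine (Finset.abs_sum_le_sum_abs _ _).trans ((Finset.sum_le_sum
      (g := fun _ => L * ‖e - e'‖) fun i _ => ?_).trans_eq ?_)
    · exact (h.logProb_lip i).norm_sub_le he he'
    · simp [mul_assoc]
  rw [h.weight_eq_exp t he, h.weight_eq_exp t he', ← mul_sub, ← mul_add, abs_mul, mul_assoc,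
    abs_of_nonneg (by positivity : (0 : ℝ) ≤ (Fintype.card X : ℝ) ^ t)]
  refine mul_le_mul_of_nonneg_left ?_ (by positivity)
  exact (abs_exp_sub_exp_le _ _).trans (mul_le_mul_of_nonneg_left hS (by positivity))

theorem hasFDerivAt_weight (h : P.RegularPath s₀ Φ K e₀ r L ω) (hr : 0 < r) (t : ℕ) :
    HasFDerivAt (fun e => P.weight (Φ e) (K e) s₀ t ω)
      (P.weight (Φ e₀) (K e₀) s₀ t ω • ∑ i ∈ Finset.range t,
        fderiv ℝ (fun e => P.logProb (Φ e) (K e) s₀ ω i) e₀) e₀ := by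
  have h1 : HasFDerivAt (fun e => (Fintype.card X : ℝ) ^ t *
      Real.exp (∑ i ∈ Finset.range t, P.logProb (Φ e) (K e) s₀ ω i)) _ e₀ :=
    ((HasFDerivAt.fun_sum fun i _ => (h.logProb_diff i).hasFDerivAt).exp).const_mul _
  rw [smul_smul, ← h.weight_eq_exp t (Metric.mem_ball_self hr)] at h1
  refine h1.congr_of_eventuallyEq ?_
  filter_upwards [Metric.ball_mem_nhds e₀ hr] with e he
  exact h.weight_eq_exp t he

theorem hasFDerivAt_weight_mul_cost (h : P.RegularPath s₀ Φ K e₀ r L ω) (hr : 0 < r) (t : ℕ) :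
    HasFDerivAt (fun e => P.weight (Φ e) (K e) s₀ (t + 1) ω * P.cost (K e) s₀ ω t)
      (P.weight (Φ e₀) (K e₀) s₀ (t + 1) ω • (fderiv ℝ (fun e => P.cost (K e) s₀ ω t) e₀
        + P.cost (K e₀) s₀ ω t • ∑ i ∈ Finset.range (t + 1),
          fderiv ℝ (fun e => P.logProb (Φ e) (K e) s₀ ω i) e₀)) e₀ := by
  have h1 := (h.hasFDerivAt_weight hr (t + 1)).mul (h.cost_diff t).hasFDerivAt
  rw [smul_comm] at h1
  rwa [smul_add]

/-- The factor `weight + weight`, rather than a bound for it, keeps the Lipschitz constant of the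
expected cost at time `t` linear in `t`, as the weights have integral one. -/
theorem abs_weight_mul_cost_sub_le {C : ℝ}
    (hC : ∀ s ∈ M.states, ∀ x, ∀ b ∈ M.feasible x, ∀ ξ, |M.c s x b ξ| ≤ C)
    (hs₀ : s₀ ∈ M.states) (h : P.RegularPath s₀ Φ K e₀ r L ω) (t : ℕ) {e e' : E}
    (he : e ∈ Metric.ball e₀ r) (he' : e' ∈ Metric.ball e₀ r) :
    |P.weight (Φ e) (K e) s₀ (t + 1) ω * P.cost (K e) s₀ ω t
        - P.weight (Φ e') (K e') s₀ (t + 1) ω * P.cost (K e') s₀ ω t|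
      ≤ (P.weight (Φ e) (K e) s₀ (t + 1) ω + P.weight (Φ e') (K e') s₀ (t + 1) ω) *
        (((t + 1) * C + 1) * L * ‖e - e'‖) := by
  have h1 := h.abs_weight_sub_le (t + 1) he he'
  have h2 : |P.cost (K e) s₀ ω t - P.cost (K e') s₀ ω t| ≤ L * ‖e - e'‖ :=
    (h.cost_lip t).norm_sub_le he he'
  have h3 := P.abs_cost_le hC hs₀ (K e) ω t
  have w1 := P.weight_nonneg (Φ e) (K e) s₀ (t + 1) ω
  have w2 := P.weight_nonneg (Φ e') (K e') s₀ (t + 1) ω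
  generalize P.weight (Φ e) (K e) s₀ (t + 1) ω = a at *
  generalize P.weight (Φ e') (K e') s₀ (t + 1) ω = b at *
  generalize P.cost (K e) s₀ ω t = x at *
  generalize P.cost (K e') s₀ ω t = y at *
  have hL : 0 ≤ L * ‖e - e'‖ := by positivity
  push_cast at h1
  calc |a * x - b * y| = |(a - b) * x + b * (x - y)| := by ring_nf
    _ ≤ |a - b| * |x| + b * |x - y| := (abs_add_le _ _).trans_eq (by
        rw [abs_mul, abs_mul, abs_of_nonneg w2])
    _ ≤ (a + b) * ((t + 1) * L * ‖e - e'‖) * C + (a + b) * (L * ‖e - e'‖) :=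
        add_le_add (mul_le_mul h1 h3 (abs_nonneg _) ((abs_nonneg _).trans h1))
          (mul_le_mul (by linarith) h2 (abs_nonneg _) (by linarith))
    _ = _ := by ring

end RegularPath

end HybridPolicy

/-- Discounted series of Riesz representatives of bounded random functionals. -/
theorem SeriesIntegrable.discounted_toDual_symm {Ω E : Type*} [MeasurableSpace Ω]
    [NormedAddCommGroup E] [InnerProductSpace ℝ E] [CompleteSpace E] {μ : Measure Ω}
    [IsProbabilityMeasure μ] {γ : ℝ} (hγ : 0 ≤ γ) (hγ1 : γ < 1) {T : ℕ → Ω → E →L[ℝ] ℝ}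
    (hT : ∀ t, AEStronglyMeasurable (T t) μ) {L : ℝ} (hL : ∀ᵐ ω ∂μ, ∀ t, ‖T t ω‖ ≤ L)
    {q : ℕ → Ω → ℝ} (hq : ∀ t, Measurable (q t)) {B : ℝ} (hB : ∀ t ω, |q t ω| ≤ B) :
    SeriesIntegrable μ
      (fun ω t => (γ ^ t * q t ω) • (InnerProductSpace.toDual ℝ E).symm (T t ω)) ∧
    ∀ v, inner ℝ (∫ ω, ∑' t, (γ ^ t * q t ω) • (InnerProductSpace.toDual ℝ E).symm (T t ω) ∂μ) v
      = ∑' t, γ ^ t * ∫ ω, T t ω v * q t ω ∂μ := by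
  have hm : ∀ t, AEStronglyMeasurable
      (fun ω => (γ ^ t * q t ω) • (InnerProductSpace.toDual ℝ E).symm (T t ω)) μ := fun t =>
    ((hq t).const_mul _).aestronglyMeasurable.smul
      ((InnerProductSpace.toDual ℝ E).symm.continuous.comp_aestronglyMeasurable (hT t))
  have hb : ∀ᵐ ω ∂μ, ∀ t, ‖(γ ^ t * q t ω) • (InnerProductSpace.toDual ℝ E).symm (T t ω)‖
      ≤ γ ^ t * (B * L) := by
    filter_upwards [hL] with ω h t
    have h0 : 0 ≤ γ ^ t := pow_nonneg hγ t
    rw [norm_smul, norm_mul, LinearIsometryEquiv.norm_map, Real.norm_of_nonneg h0, mul_assoc]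
    exact mul_le_mul_of_nonneg_left (mul_le_mul (hB t ω) (h t) (norm_nonneg _)
      ((abs_nonneg _).trans (hB t ω))) h0
  have hs : Summable fun t : ℕ => γ ^ t * (B * L) :=
    (summable_geometric_of_lt_one hγ hγ1).mul_right _
  obtain ⟨h1, h2⟩ := SeriesIntegrable.of_norm_le hm hb hs
  refine ⟨h1, fun v => ?_⟩
  have h3 := (h2.mapL (innerSL ℝ v)).tsum_eq
  simp only [innerSL_apply_apply] at h3
  rw [real_inner_comm, ← h3]
  refine tsum_congr fun t => ?_
  rw [← integral_inner (Integrable.of_bound (hm t) _ (hb.mono fun ω h => h t)),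
    ← integral_const_mul]
  refine integral_congr_ae (.of_forall fun ω => ?_)
  simp only [inner_smul_right]
  rw [real_inner_comm, InnerProductSpace.toDual_symm_apply]
  ring

namespace HybridPolicy

variable {X Ξ : Type*} [Fintype X] [MeasurableSpace X] [DiscreteMeasurableSpace X]
  [MeasurableSpace Ξ] {d p : ℕ} {M : HybridMDP X Ξ d p} {m n : ℕ} (P : HybridPolicy M m n)

/-! ### Derivative of the objective along a smooth family of parameters -/

section Family

variable {E : Type*} [NormedAddCommGroup E] [NormedSpace ℝ E] {s₀ : EuclideanSpace ℝ (Fin d)}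
  {Φ : E → EuclideanSpace ℝ (Fin m)} {K : E → EuclideanSpace ℝ (Fin n)} {e₀ : E} {r : ℝ}
  {L : NNReal} {C : ℝ}

theorem exists_measurable_eq_fderiv_logProb (s₀ : EuclideanSpace ℝ (Fin d))
    (Φ : E → EuclideanSpace ℝ (Fin m)) (K : E → EuclideanSpace ℝ (Fin n)) (e₀ v : E) (hr : 0 < r)
    (L : NNReal) (t : ℕ) :
    ∃ G : (ℕ → X × Ξ) → ℝ, Measurable G ∧ (∀ ω, |G ω| ≤ L * ‖v‖) ∧
      (∀ ω ω', (∀ i < t, ω i = ω' i) → (ω t).1 = (ω' t).1 → G ω = G ω') ∧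
      ∀ ω, P.RegularPath s₀ Φ K e₀ r L ω →
        G ω = fderiv ℝ (fun e => P.logProb (Φ e) (K e) s₀ ω t) e₀ v := by
  obtain ⟨G, h1, h2, h3, h4⟩ := exists_measurable_eq_fderiv
    (F := fun e ω => P.logProb (Φ e) (K e) s₀ ω t)
    (fun e => (P.measurable_prob (Φ e) (K e) s₀ t).log) e₀ v (B := L * ‖v‖) (by positivity)
  exact ⟨G, h1, h2, fun ω ω' h hx => h3 ω ω' fun e => by
    rw [logProb, logProb, P.prob_congr _ _ _ h hx], fun ω h => h4 ω (h.logProb_diff t)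
    (((fderiv ℝ _ e₀).le_opNorm v).trans
      (mul_le_mul_of_nonneg_right (h.norm_fderiv_logProb_le hr t) (norm_nonneg v)))⟩

theorem exists_measurable_eq_fderiv_cost (s₀ : EuclideanSpace ℝ (Fin d))
    (Φ : E → EuclideanSpace ℝ (Fin m)) (K : E → EuclideanSpace ℝ (Fin n)) (e₀ v : E) (hr : 0 < r)
    (L : NNReal) (t : ℕ) :
    ∃ G : (ℕ → X × Ξ) → ℝ, Measurable G ∧ (∀ ω, |G ω| ≤ L * ‖v‖) ∧
      DependsOn G (Set.Iio (t + 1)) ∧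
      ∀ ω, P.RegularPath s₀ Φ K e₀ r L ω →
        G ω = fderiv ℝ (fun e => P.cost (K e) s₀ ω t) e₀ v := by
  obtain ⟨G, h1, h2, h3, h4⟩ := exists_measurable_eq_fderiv
    (F := fun e ω => P.cost (K e) s₀ ω t)
    (fun e => P.measurable_cost (K e) s₀ t) e₀ v (B := L * ‖v‖) (by positivity)
  exact ⟨G, h1, h2, fun ω ω' h => h3 ω ω' fun e => P.cost_congr _ _ h,
    fun ω h => h4 ω (h.cost_diff t)
    (((fderiv ℝ _ e₀).le_opNorm v).trans
      (mul_le_mul_of_nonneg_right (h.norm_fderiv_cost_le hr t) (norm_nonneg v)))⟩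

/-- The Lipschitz constant of the expected cost at time `t` grows only linearly in `t`, hence is
summable against the discount. -/
theorem abs_integral_cost_sub_le
    (hC : ∀ s ∈ M.states, ∀ x, ∀ b ∈ M.feasible x, ∀ ξ, |M.c s x b ξ| ≤ C)
    (hs₀ : s₀ ∈ M.states)
    (hreg : ∀ᵐ ω ∂P.refLaw s₀, P.RegularPath s₀ Φ K e₀ r L ω) (t : ℕ) {e e' : E}
    (he : e ∈ Metric.ball e₀ r) (he' : e' ∈ Metric.ball e₀ r) :
    |∫ ω, P.cost (K e) s₀ ω t ∂P.law (Φ e) (K e) s₀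
        - ∫ ω, P.cost (K e') s₀ ω t ∂P.law (Φ e') (K e') s₀|
      ≤ 2 * (((t + 1) * C + 1) * L) * ‖e - e'‖ := by
  have hw : ∀ e, Integrable (fun ω => P.weight (Φ e) (K e) s₀ (t + 1) ω) (P.refLaw s₀) :=
    fun e => Integrable.of_bound (P.measurable_weight _ _ _ _).aestronglyMeasurable
      ((Fintype.card X : ℝ) ^ (t + 1)) (.of_forall fun ω => by
        rw [Real.norm_of_nonneg (P.weight_nonneg _ _ _ _ _)]
        exact P.weight_le _ _ _ _ _)
  have hwc : ∀ e, Integrable (fun ω => P.weight (Φ e) (K e) s₀ (t + 1) ω * P.cost (K e) s₀ ω t)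
      (P.refLaw s₀) := fun e => (hw e).mul_bdd
        (P.measurable_cost _ _ _).aestronglyMeasurable
        (.of_forall fun ω => P.abs_cost_le hC hs₀ _ ω t)
  have hE : ∀ e, ∫ ω, P.cost (K e) s₀ ω t ∂P.law (Φ e) (K e) s₀
      = ∫ ω, P.weight (Φ e) (K e) s₀ (t + 1) ω * P.cost (K e) s₀ ω t ∂P.refLaw s₀ := fun e =>
    P.integral_law_eq_integral_weight (Φ e) (K e) s₀ (t := t + 1) (P.measurable_cost _ _ _)
      (fun ω => P.abs_cost_le hC hs₀ _ ω t) fun ω ω' h => P.cost_congr _ _ h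
  rw [hE, hE, ← integral_sub (hwc e) (hwc e')]
  refine (norm_integral_le_of_norm_le
    (f := fun ω => P.weight (Φ e) (K e) s₀ (t + 1) ω * P.cost (K e) s₀ ω t
      - P.weight (Φ e') (K e') s₀ (t + 1) ω * P.cost (K e') s₀ ω t)
    (g := fun ω => (P.weight (Φ e) (K e) s₀ (t + 1) ω + P.weight (Φ e') (K e') s₀ (t + 1) ω) *
      (((t + 1) * C + 1) * L * ‖e - e'‖)) (((hw e).add (hw e')).mul_const _)
    (hreg.mono fun ω h => h.abs_weight_mul_cost_sub_le hC hs₀ t he he')).trans_eq ?_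
  rw [integral_mul_const, integral_add (hw e) (hw e'), P.integral_weight, P.integral_weight]
  ring

variable [FiniteDimensional ℝ E]

theorem aestronglyMeasurable_fderiv_logProb {μ : Measure (ℕ → X × Ξ)} (hr : 0 < r)
    (hreg : ∀ᵐ ω ∂μ, P.RegularPath s₀ Φ K e₀ r L ω) (t : ℕ) :
    AEStronglyMeasurable (fun ω => fderiv ℝ (fun e => P.logProb (Φ e) (K e) s₀ ω t) e₀) μ :=
  aestronglyMeasurable_of_apply fun v => by
    obtain ⟨G, hG, -, -, h⟩ := P.exists_measurable_eq_fderiv_logProb s₀ Φ K e₀ v hr L t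
    exact hG.aestronglyMeasurable.congr (hreg.mono fun ω hω => h ω hω)

theorem aestronglyMeasurable_fderiv_cost {μ : Measure (ℕ → X × Ξ)} (hr : 0 < r)
    (hreg : ∀ᵐ ω ∂μ, P.RegularPath s₀ Φ K e₀ r L ω) (t : ℕ) :
    AEStronglyMeasurable (fun ω => fderiv ℝ (fun e => P.cost (K e) s₀ ω t) e₀) μ :=
  aestronglyMeasurable_of_apply fun v => by
    obtain ⟨G, hG, -, -, h⟩ := P.exists_measurable_eq_fderiv_cost s₀ Φ K e₀ v hr L t
    exact hG.aestronglyMeasurable.congr (hreg.mono fun ω hω => h ω hω)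

/-- The derivative of the expected cost at time `t` is the expectation of the pathwise derivative
plus, for each action drawn up to time `t`, a likelihood-ratio contribution. -/
theorem exists_hasFDerivAt_integral_cost
    (hC : ∀ s ∈ M.states, ∀ x, ∀ b ∈ M.feasible x, ∀ ξ, |M.c s x b ξ| ≤ C)
    (hs₀ : s₀ ∈ M.states) (hr : 0 < r)
    (hreg : ∀ᵐ ω ∂P.refLaw s₀, P.RegularPath s₀ Φ K e₀ r L ω)
    (hreg' : ∀ᵐ ω ∂P.law (Φ e₀) (K e₀) s₀, P.RegularPath s₀ Φ K e₀ r L ω) (t : ℕ) :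
    ∃ D : E →L[ℝ] ℝ,
      HasFDerivAt (fun e => ∫ ω, P.cost (K e) s₀ ω t ∂P.law (Φ e) (K e) s₀) D e₀ ∧
      ∀ v, D v = ∫ ω, fderiv ℝ (fun e => P.cost (K e) s₀ ω t) e₀ v ∂P.law (Φ e₀) (K e₀) s₀
        + ∑ i ∈ Finset.range (t + 1), ∫ ω, fderiv ℝ (fun e => P.logProb (Φ e) (K e) s₀ ω i) e₀ v *
            P.cost (K e₀) s₀ ω t ∂P.law (Φ e₀) (K e₀) s₀ := by
  have hX := P.card_actions_pos
  have hcost : ∀ e ω, |P.cost (K e) s₀ ω t| ≤ C := fun e ω => P.abs_cost_le hC hs₀ (K e) ω t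
  obtain ⟨ω₀⟩ := (P.refLaw s₀).nonempty_of_neZero
  have hC0 : 0 ≤ C := (abs_nonneg _).trans (hcost e₀ ω₀)
  have hE : ∀ e, ∫ ω, P.cost (K e) s₀ ω t ∂P.law (Φ e) (K e) s₀
      = ∫ ω, P.weight (Φ e) (K e) s₀ (t + 1) ω * P.cost (K e) s₀ ω t ∂P.refLaw s₀ := fun e =>
    P.integral_law_eq_integral_weight (Φ e) (K e) s₀ (t := t + 1) (P.measurable_cost _ _ _)
      (hcost e) fun ω ω' h => P.cost_congr _ _ h
  simp only [hE]
  have hmeas : ∀ e, AEStronglyMeasurable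
      (fun ω => P.weight (Φ e) (K e) s₀ (t + 1) ω * P.cost (K e) s₀ ω t) (P.refLaw s₀) :=
    fun e => ((P.measurable_weight _ _ _ _).mul (P.measurable_cost _ _ _)).aestronglyMeasurable
  have hF' : AEStronglyMeasurable (fun ω => P.weight (Φ e₀) (K e₀) s₀ (t + 1) ω •
      (fderiv ℝ (fun e => P.cost (K e) s₀ ω t) e₀ + P.cost (K e₀) s₀ ω t •
        ∑ i ∈ Finset.range (t + 1), fderiv ℝ (fun e => P.logProb (Φ e) (K e) s₀ ω i) e₀))
      (P.refLaw s₀) :=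
    (P.measurable_weight _ _ _ _).aestronglyMeasurable.smul
      ((P.aestronglyMeasurable_fderiv_cost hr hreg t).add
        ((P.measurable_cost _ _ _).aestronglyMeasurable.smul
          (Finset.aestronglyMeasurable_fun_sum _ fun i _ =>
            P.aestronglyMeasurable_fderiv_logProb hr hreg i)))
  have hbd : ∀ e ω, ‖P.weight (Φ e) (K e) s₀ (t + 1) ω * P.cost (K e) s₀ ω t‖
      ≤ (Fintype.card X : ℝ) ^ (t + 1) * C := fun e ω => by
    rw [norm_mul, Real.norm_of_nonneg (P.weight_nonneg _ _ _ _ _)]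
    exact mul_le_mul (P.weight_le _ _ _ _ _) (hcost e ω) (abs_nonneg _) (by positivity)
  set b : ℝ := (2 * (Fintype.card X : ℝ) ^ (t + 1)) * (((t + 1) * C + 1) * L) with hb
  have hb0 : 0 ≤ b := by positivity
  obtain ⟨hint, hder⟩ := hasFDerivAt_integral_of_dominated_loc_of_lip (μ := P.refLaw s₀)
    (bound := fun _ => b) (Metric.ball_mem_nhds e₀ hr) (.of_forall hmeas)
    (Integrable.of_bound (hmeas e₀) _ (.of_forall (hbd e₀))) hF'
    (hreg.mono fun ω h => by
      rw [Real.nnabs_of_nonneg hb0]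
      refine LipschitzOnWith.of_dist_le' fun e he e' he' => ?_
      rw [Real.dist_eq, dist_eq_norm]
      calc _ ≤ _ := h.abs_weight_mul_cost_sub_le hC hs₀ t he he'
        _ ≤ (2 * (Fintype.card X : ℝ) ^ (t + 1)) * (((t + 1) * C + 1) * L * ‖e - e'‖) := by
            refine mul_le_mul_of_nonneg_right ?_ (by positivity)
            linarith [P.weight_le (Φ e) (K e) s₀ (t + 1) ω,
              P.weight_le (Φ e') (K e') s₀ (t + 1) ω]
        _ = b * ‖e - e'‖ := by rw [hb]; ring)
    (integrable_const _) (hreg.mono fun ω h => h.hasFDerivAt_weight_mul_cost hr t)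
  refine ⟨_, hder, fun v => ?_⟩
  -- The change of measure back to the law of the process needs integrands that are measurable and
  -- determined by the first `t + 1` steps, whereas the derivatives exist only almost everywhere.
  rw [ContinuousLinearMap.integral_apply hint]
  obtain ⟨Gc, hc1, hc2, hc3, hc4⟩ := P.exists_measurable_eq_fderiv_cost s₀ Φ K e₀ v hr L t
  choose Gl hl1 hl2 hl3 hl4 using P.exists_measurable_eq_fderiv_logProb s₀ Φ K e₀ v hr L
  have hlc : ∀ i, Measurable fun ω => Gl i ω * P.cost (K e₀) s₀ ω t := fun i =>
    (hl1 i).mul (P.measurable_cost _ _ _)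
  have hlcb : ∀ i ω, |Gl i ω * P.cost (K e₀) s₀ ω t| ≤ L * ‖v‖ * C := fun i ω => by
    rw [abs_mul]
    exact mul_le_mul (hl2 i ω) (hcost e₀ ω) (abs_nonneg _) (by positivity)
  have hLaw := P.integral_law_eq_integral_weight (Φ e₀) (K e₀) s₀ (t := t + 1)
    (F := fun ω => Gc ω + ∑ i ∈ Finset.range (t + 1), Gl i ω * P.cost (K e₀) s₀ ω t)
    (hc1.add (Finset.measurable_sum _ fun i _ => hlc i))
    (C := L * ‖v‖ + ∑ i ∈ Finset.range (t + 1), L * ‖v‖ * C)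
    (fun ω => (abs_add_le _ _).trans (add_le_add (hc2 ω) ((Finset.abs_sum_le_sum_abs _ _).trans
      (Finset.sum_le_sum fun i _ => hlcb i ω))))
    (fun ω ω' h => by
      simp only [hc3 h, P.cost_congr (K e₀) s₀ h]
      congr 1
      refine Finset.sum_congr rfl fun i hi => ?_
      have hi := Finset.mem_range.1 hi
      rw [hl3 i ω ω' (fun j hj => h j (hj.trans hi)) (by rw [h i hi])])
  have hIc : Integrable Gc (P.law (Φ e₀) (K e₀) s₀) :=
    Integrable.of_bound hc1.aestronglyMeasurable _ (.of_forall hc2)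
  have hIl : ∀ i, Integrable (fun ω => Gl i ω * P.cost (K e₀) s₀ ω t)
      (P.law (Φ e₀) (K e₀) s₀) := fun i =>
    Integrable.of_bound (hlc i).aestronglyMeasurable _ (.of_forall (hlcb i))
  rw [integral_add hIc (integrable_finsetSum _ fun i _ => hIl i),
    integral_finsetSum _ fun i _ => hIl i] at hLaw
  have e1 : ∫ ω, fderiv ℝ (fun e => P.cost (K e) s₀ ω t) e₀ v ∂P.law (Φ e₀) (K e₀) s₀
      = ∫ ω, Gc ω ∂P.law (Φ e₀) (K e₀) s₀ :=
    integral_congr_ae (hreg'.mono fun ω h => (hc4 ω h).symm)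
  have e2 : ∀ i, ∫ ω, fderiv ℝ (fun e => P.logProb (Φ e) (K e) s₀ ω i) e₀ v *
      P.cost (K e₀) s₀ ω t ∂P.law (Φ e₀) (K e₀) s₀
      = ∫ ω, Gl i ω * P.cost (K e₀) s₀ ω t ∂P.law (Φ e₀) (K e₀) s₀ := fun i =>
    integral_congr_ae (hreg'.mono fun ω h => by simp only [hl4 i ω h])
  simp only [e1, e2, hLaw]
  refine integral_congr_ae (hreg.mono fun ω h => ?_)
  simp only [hc4 ω h, hl4 _ ω h, _root_.smul_apply, _root_.add_apply, _root_.sum_apply,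
    smul_eq_mul, Finset.sum_mul, mul_comm (P.cost (K e₀) s₀ ω t)]

/-- The policy gradient theorem along a family of parameters. -/
theorem exists_hasFDerivAt_J
    (hC : ∀ s ∈ M.states, ∀ x, ∀ b ∈ M.feasible x, ∀ ξ, |M.c s x b ξ| ≤ C)
    (hs₀ : s₀ ∈ M.states) (hr : 0 < r)
    (hreg : ∀ᵐ ω ∂P.refLaw s₀, P.RegularPath s₀ Φ K e₀ r L ω)
    (hreg' : ∀ᵐ ω ∂P.law (Φ e₀) (K e₀) s₀, P.RegularPath s₀ Φ K e₀ r L ω) :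
    ∃ D : E →L[ℝ] ℝ, HasFDerivAt (fun e => P.J s₀ (Φ e) (K e)) D e₀ ∧
      ∀ v, D v = ∑' t, M.γ ^ t *
          ∫ ω, fderiv ℝ (fun e => P.cost (K e) s₀ ω t) e₀ v ∂P.law (Φ e₀) (K e₀) s₀
        + ∑' t, M.γ ^ t * ∫ ω, fderiv ℝ (fun e => P.logProb (Φ e) (K e) s₀ ω t) e₀ v *
            P.Q (Φ e₀) (K e₀) (P.state (K e₀) s₀ ω t) (ω t).1 (P.action (K e₀) s₀ ω t)
            ∂P.law (Φ e₀) (K e₀) s₀ := by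
  obtain ⟨ω₀⟩ := (P.refLaw s₀).nonempty_of_neZero
  have hC0 : 0 ≤ C := (abs_nonneg _).trans (P.abs_cost_le hC hs₀ (K e₀) ω₀ 0)
  have hγ := M.γ_pos
  choose D hD hDv using P.exists_hasFDerivAt_integral_cost hC hs₀ hr hreg hreg'
  have hJ : ∀ e, HasSum (fun t => M.γ ^ t * ∫ ω, P.cost (K e) s₀ ω t ∂P.law (Φ e) (K e) s₀)
      (P.J s₀ (Φ e) (K e)) := fun e => (P.seriesIntegrable_cost hC hs₀ (Φ e) (K e)).2
  have hb : Summable fun t : ℕ => M.γ ^ t * (2 * (((t + 1) * C + 1) * L)) := by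
    have hγn : ‖M.γ‖ < 1 := by rw [Real.norm_of_nonneg hγ.le]; exact M.γ_lt_one
    have h1 := (summable_pow_mul_geometric_of_norm_lt_one 1 hγn).mul_right (2 * (C * L))
    have h2 := summable_discount_mul (M := M) (2 * ((C + 1) * L))
    refine (h1.add h2).congr fun t => ?_
    ring
  obtain ⟨hsum, hder⟩ := hasFDerivAt_tsum_of_lipschitzOn
    (g := fun t e => M.γ ^ t * ∫ ω, P.cost (K e) s₀ ω t ∂P.law (Φ e) (K e) s₀)
    (Metric.ball_mem_nhds e₀ hr) (fun t => (hD t).const_mul (M.γ ^ t))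
    (fun t => by
      rw [Real.nnabs_of_nonneg (by positivity)]
      refine LipschitzOnWith.of_dist_le' fun e he e' he' => ?_
      rw [Real.dist_eq, dist_eq_norm, ← mul_sub, mul_assoc]
      exact abs_discount_mul_le t (P.abs_integral_cost_sub_le hC hs₀ hreg t he he'))
    hb (fun e => (hJ e).summable)
  simp only [(hJ _).tsum_eq] at hder
  refine ⟨_, hder, fun v => ?_⟩
  have hv : HasSum (fun t => M.γ ^ t * D t v) ((∑' t, M.γ ^ t • D t) v) :=
    hsum.hasSum.mapL (ContinuousLinearMap.apply ℝ ℝ v)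
  rw [← hv.tsum_eq]
  have hcost : Summable fun t => M.γ ^ t *
      ∫ ω, fderiv ℝ (fun e => P.cost (K e) s₀ ω t) e₀ v ∂P.law (Φ e₀) (K e₀) s₀ := by
    refine Summable.of_norm_bounded (summable_discount_mul (M := M) (L * ‖v‖)) fun t =>
      abs_discount_mul_le t ?_
    obtain ⟨G, -, h2, -, h4⟩ := P.exists_measurable_eq_fderiv_cost s₀ Φ K e₀ v hr L t
    rw [integral_congr_ae (hreg'.mono fun ω h => (h4 ω h).symm)]
    exact abs_integral_le_of_abs_le h2
  -- The likelihood-ratio contributions form a double series indexed by the time `i` of the action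
  -- and the delay `k` of the cost; it is summed along `i + k = t` and along `i`.
  choose Gl hl1 hl2 hl3 hl4 using P.exists_measurable_eq_fderiv_logProb s₀ Φ K e₀ v hr L
  have hGl : ∀ i (f : (ℕ → X × Ξ) → ℝ),
      ∫ ω, fderiv ℝ (fun e => P.logProb (Φ e) (K e) s₀ ω i) e₀ v * f ω ∂P.law (Φ e₀) (K e₀) s₀
        = ∫ ω, Gl i ω * f ω ∂P.law (Φ e₀) (K e₀) s₀ := fun i f =>
    integral_congr_ae (hreg'.mono fun ω h => by simp only [hl4 i ω h])
  simp only [hDv, hGl, mul_add]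
  let a : ℕ → ℕ → ℝ := fun i k => M.γ ^ i * (M.γ ^ k *
    ∫ ω, Gl i ω * P.cost (K e₀) s₀ ω (i + k) ∂P.law (Φ e₀) (K e₀) s₀)
  have ha : Summable fun z : ℕ × ℕ => a z.1 z.2 := by
    have hg := summable_geometric_of_lt_one hγ.le M.γ_lt_one
    refine Summable.of_norm_bounded ((hg.mul_of_nonneg hg (fun _ => by positivity)
      fun _ => by positivity).mul_right (L * ‖v‖ * C)) fun z => ?_
    rw [mul_assoc]
    refine abs_discount_mul_le z.1 (abs_discount_mul_le z.2 (abs_integral_le_of_abs_le fun ω => ?_))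
    rw [abs_mul]
    exact mul_le_mul (hl2 _ ω) (P.abs_cost_le hC hs₀ _ ω _) (abs_nonneg _) (by positivity)
  have hrow := ha.hasSum.prod_fiberwise fun i =>
    (P.hasSum_integral_mul_cost hC hs₀ (Φ e₀) (K e₀) (hl1 i) (hl2 i) (hl3 i)).mul_left (M.γ ^ i)
  have hdiag := hasSum_sum_range_of_hasSum_prod ha.hasSum
  have hdiag' : ∀ t, ∑ i ∈ Finset.range (t + 1), a i (t - i) = M.γ ^ t *
      ∑ i ∈ Finset.range (t + 1),
        ∫ ω, Gl i ω * P.cost (K e₀) s₀ ω t ∂P.law (Φ e₀) (K e₀) s₀ := fun t => by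
    rw [Finset.mul_sum]
    refine Finset.sum_congr rfl fun i hi => ?_
    have hi : i + (t - i) = t := by have := Finset.mem_range.1 hi; omega
    simp only [a]
    rw [← mul_assoc, ← pow_add, hi]
  simp only [hdiag'] at hdiag
  rw [hcost.tsum_add hdiag.summable, hdiag.tsum_eq, hrow.tsum_eq]

end Family

end HybridPolicy

end

/-! ### The two gradients -/

theorem theorem1 {X Ξ : Type*} [Fintype X] [MeasurableSpace X] [DiscreteMeasurableSpace X]
    [MeasurableSpace Ξ] {d p m n : ℕ} (M : HybridMDP X Ξ d p) (P : HybridPolicy M m n)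
    (s₀ : EuclideanSpace ℝ (Fin d)) (hs₀ : s₀ ∈ M.states)
    (hM : M.SmoothDynamics) (hP : P.Regular s₀)
    (φ : EuclideanSpace ℝ (Fin m)) (κ : EuclideanSpace ℝ (Fin n)) :
    SeriesIntegrable (P.law φ κ s₀) (fun ω t => M.γ ^ t * P.cost κ s₀ ω t) ∧
    SeriesIntegrable (P.law φ κ s₀) (P.scoreTerm s₀ φ κ) ∧
    SeriesIntegrable (P.law φ κ s₀) (P.pathwiseTerm s₀ κ) ∧
    SeriesIntegrable (P.law φ κ s₀) (P.crossTerm s₀ φ κ) ∧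
    HasGradientAt (fun φ' => P.J s₀ φ' κ)
      (∫ ω, ∑' t, P.scoreTerm s₀ φ κ ω t ∂(P.law φ κ s₀)) φ ∧
    HasGradientAt (fun κ' => P.J s₀ φ κ')
      ((∫ ω, ∑' t, P.pathwiseTerm s₀ κ ω t ∂(P.law φ κ s₀)) +
        ∫ ω, ∑' t, P.crossTerm s₀ φ κ ω t ∂(P.law φ κ s₀)) κ ∧
    (P.JointlyDifferentiable s₀ φ κ →
      DifferentiableAt ℝ
        (fun θ : EuclideanSpace ℝ (Fin m) × EuclideanSpace ℝ (Fin n) => P.J s₀ θ.1 θ.2)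
        (φ, κ)) := by
  obtain ⟨C, hC⟩ := hP.cost_bounded
  obtain ⟨r, hr, L, hL⟩ := hP.grad_bounded φ κ
  have hφ0 : φ ∈ Metric.ball φ r := Metric.mem_ball_self hr
  have hκ0 : κ ∈ Metric.ball κ r := Metric.mem_ball_self hr
  have hγ := M.γ_pos.le
  have hγ1 := M.γ_lt_one
  have regφ : ∀ᵐ ξ ∂M.scenarioLaw, ∀ x, P.RegularPath s₀ (fun φ' => φ') (fun _ => κ) φ r L
      (HybridPolicy.realization x ξ) := by
    filter_upwards [hL, hP.grad_exists φ κ] with ξ h1 h2 x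
    exact ⟨fun t e he => (h1 x t).1 e he κ hκ0, fun t => (h1 x t).2.1 κ hκ0,
      fun t => LipschitzOnWith.of_dist_le_mul fun _ _ _ _ => by simp; positivity,
      fun t => (h2 x t).1, fun t => differentiableAt_const _⟩
  have regκ : ∀ᵐ ξ ∂M.scenarioLaw, ∀ x, P.RegularPath s₀ (fun _ => φ) (fun κ' => κ') κ r L
      (HybridPolicy.realization x ξ) := by
    filter_upwards [hL, hP.grad_exists φ κ] with ξ h1 h2 x
    exact ⟨fun t e he => (h1 x t).1 φ hφ0 e he, fun t => (h1 x t).2.2.1 φ hφ0,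
      fun t => (h1 x t).2.2.2, fun t => (h2 x t).2.1, fun t => (h2 x t).2.2⟩
  have regφ' := P.ae_law_of_ae_scenario φ κ s₀ regφ
  have regκ' := P.ae_law_of_ae_scenario φ κ s₀ regκ
  have hQm := fun t => P.measurable_Q_state hC hs₀ φ κ t
  have hQb : ∀ t ω, |P.Q φ κ (P.state κ s₀ ω t) (ω t).1 (P.action κ s₀ ω t)|
      ≤ ∑' t, M.γ ^ t * C := fun t ω => P.abs_Q_le hC φ κ (P.state_mem hs₀ κ ω t) _
  obtain ⟨hscore, hscore_v⟩ := SeriesIntegrable.discounted_toDual_symm hγ hγ1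
    (fun t => P.aestronglyMeasurable_fderiv_logProb hr regφ' t)
    (regφ'.mono fun ω h t => h.norm_fderiv_logProb_le hr t) hQm hQb
  obtain ⟨hcross, hcross_v⟩ := SeriesIntegrable.discounted_toDual_symm hγ hγ1
    (fun t => P.aestronglyMeasurable_fderiv_logProb hr regκ' t)
    (regκ'.mono fun ω h t => h.norm_fderiv_logProb_le hr t) hQm hQb
  obtain ⟨hpath, hpath_v⟩ := SeriesIntegrable.discounted_toDual_symm hγ hγ1
    (fun t => P.aestronglyMeasurable_fderiv_cost hr regκ' t)
    (regκ'.mono fun ω h t => h.norm_fderiv_cost_le hr t) (q := fun _ _ => 1)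
    (fun _ => measurable_const) (B := 1) (by simp)
  simp only [mul_one] at hpath hpath_v
  refine ⟨(P.seriesIntegrable_cost hC hs₀ φ κ).1, hscore, hpath, hcross, ?_, ?_, fun hJD => ?_⟩
  · obtain ⟨D, hD, hDv⟩ := P.exists_hasFDerivAt_J hC hs₀ hr
      (P.uniform.ae_law_of_ae_scenario 0 0 s₀ regφ) regφ'
    rw [hasGradientAt_iff_hasFDerivAt]
    refine hD.congr_fderiv (ContinuousLinearMap.ext fun v => ?_)
    rw [hDv, InnerProductSpace.toDual_apply_apply]
    refine Eq.trans ?_ (hscore_v v).symm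
    simp
  · obtain ⟨D, hD, hDv⟩ := P.exists_hasFDerivAt_J hC hs₀ hr
      (P.uniform.ae_law_of_ae_scenario 0 0 s₀ regκ) regκ'
    rw [hasGradientAt_iff_hasFDerivAt]
    refine hD.congr_fderiv (ContinuousLinearMap.ext fun v => ?_)
    rw [hDv, InnerProductSpace.toDual_apply_apply, inner_add_left]
    exact (congrArg₂ (· + ·) (hpath_v v) (hcross_v v)).symm
  · -- In the maximum norm of the product, Lipschitz constants in the two variables add up.
    have reg : ∀ᵐ ξ ∂M.scenarioLaw, ∀ x, P.RegularPath s₀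
        (Prod.fst : EuclideanSpace ℝ (Fin m) × EuclideanSpace ℝ (Fin n) → _) Prod.snd
        (φ, κ) r (L + L) (HybridPolicy.realization x ξ) := by
      filter_upwards [hL, hP.grad_exists φ κ, hJD] with ξ h1 h2 h3 x
      have hball : ∀ e ∈ Metric.ball (φ, κ) r,
          e.1 ∈ Metric.ball φ r ∧ e.2 ∈ Metric.ball κ r := fun e he => by
        rwa [← ball_prod_same] at he
      refine ⟨fun t e he => (h1 x t).1 _ (hball e he).1 _ (hball e he).2, fun t => ?_,
        fun t => ?_, fun t => h3 x t, fun t => ?_⟩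
      · refine LipschitzOnWith.of_dist_le_mul fun e he e' he' => ?_
        obtain ⟨-, hlφ, hlκ, -⟩ := h1 x t
        have d1 := (hlφ e.2 (hball e he).2).dist_le_mul _ (hball e he).1 _ (hball e' he').1
        have d2 := (hlκ e'.1 (hball e' he').1).dist_le_mul _ (hball e he).2 _ (hball e' he').2
        refine (dist_triangle _ _ _).trans ((add_le_add d1 d2).trans ?_)
        push_cast
        rw [add_mul]
        gcongr
        · exact le_max_left _ _
        · exact le_max_right _ _
      · refine LipschitzOnWith.of_dist_le_mul fun e he e' he' => ?_
        refine ((h1 x t).2.2.2.dist_le_mul _ (hball e he).2 _ (hball e' he').2).trans ?_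
        gcongr
        · exact le_add_self
        · exact le_max_right _ _
      · have h4 : DifferentiableAt ℝ (fun κ' => P.cost κ' s₀ (HybridPolicy.realization x ξ) t)
            (Prod.snd (φ, κ)) := (h2 x t).2.2
        exact h4.comp (φ, κ) differentiableAt_snd
    obtain ⟨D, hD, -⟩ := P.exists_hasFDerivAt_J hC hs₀ hr
      (P.uniform.ae_law_of_ae_scenario 0 0 s₀ reg) (P.ae_law_of_ae_scenario φ κ s₀ reg)
    exact hD.differentiableAt
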